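/- Let $N\ge 3$ and consider the cycle network with parties $j\in\mathbb{Z}/N$, in which party $j$ holds two qubits, one shared with party $j-1$ and one shared with party $j+1$. Let $|\Psi\rangle=\bigotimes_{e\in E}|\Psi^-\rangle_e$ be the network state, where every edge $e$ of the cycle carries a singlet $|\Psi^-\rangle=(|01\rangle-|10\rangle)/\sqrt2$ on its two qubits. Let $h=h_1\otimes\cdots\otimes h_N$ with every $h_j\in GL(4,\mathbb{C})$ acting on the two qubits of party $j$, and put $H_j=h_j^\dagger h_j$. A local symmetry of $|\Psi\rangle$ is an operator $S=\bigotimes_j S^{(j)}$ with all $S^{(j)}\in GL(4,\mathbb{C})$ and $S|\Psi\rangle=|\Psi\rangle$. States are considered up to non-zero scalars. In a finite-round LOCC protocol, in every round one party (whose choice may depend on earlier outcomes) performs a generalized measurement with finitely many Kraus operators $M_i$, $\sum_i M_i^\dagger M_i=\mathbf 1$, and communicates the outcome, whereupon the other parties apply local unitaries depending on it. A round is deterministic if all outcomes of non-zero probability lead to the same pure state. Then $h|\Psi\rangle$ can be reached with certainty from $|\Psi\rangle$ by a finite-round LOCC protocol in which each party measures at most once and every round is deterministic, if and only if there are a party $k$,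 matrices $A,B\in SL(2,\mathbb{C})$, finitely many local symmetries $S_i=\bigotimes_j S_i^{(j)}$ of $|\Psi\rangle$, probabilities $p_i\ge 0$ with $\sum_i p_i=1$, and $r\in\mathbb{R}$ such that $$(S_i^{(j)})^\dagger H_j S_i^{(j)}\propto H_j\quad\text{for all } i \text{ and all } j\ne k,$$ $$\sum_i p_i\,(S_i^{(k)})^\dagger H_k S_i^{(k)}=r\,\big(A^\dagger A\otimes B^\dagger B\big),$$ where in the last equation the first tensor factor is the qubit that party $k$ shares with party $k-1$ and the second one the qubit it shares with party $k+1$. -/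

import Mathlib

open scoped Kronecker Matrix

namespace CycleNetwork

/-- Basis labels of the two qubits held by one party: the first component labels the qubit shared
with the previous party of the cycle, the second one the qubit shared with the next party. -/
abbrev TwoQubit : Type := Fin 2 × Fin 2

/-- Operators acting on the two qubits of one party. -/
abbrev LocalOp : Type := Matrix TwoQubit TwoQubit ℂ

/-- (Not necessarily normalized) pure states of a cycle network with `N` parties, given by their
amplitudes in the product of the computational bases. -/
abbrev State (N : ℕ) : Type := (Fin N → TwoQubit) → ℂ

/-- The action of the product operator `M 0 ⊗ ⋯ ⊗ M (N - 1)` on a state. -/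
noncomputable def applyLocal {N : ℕ} (M : Fin N → LocalOp) (φ : State N) : State N :=
  fun x => ∑ y : Fin N → TwoQubit, (∏ j, M j (x j) (y j)) * φ y

/-- The amplitudes of the two-qubit singlet `(|01⟩ - |10⟩) / √2`. -/
noncomputable def singlet : Matrix (Fin 2) (Fin 2) ℂ :=
  !![0, ((1 / √2 : ℝ) : ℂ); -((1 / √2 : ℝ) : ℂ), 0]

/-- The initial state of the cycle network: for every party `j`, the second qubit of party `j` and
the first qubit of party `j + 1` (cyclically) form a singlet. -/
noncomputable def networkState (N : ℕ) [NeZero N] : State N :=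
  fun x => ∏ j : Fin N, singlet (x j).2 (x (j + 1)).1

/-- Equality of (unnormalized) states up to a scalar: `φ` is a multiple of `χ`. This also
holds for `φ = 0`, the state in a measurement branch of probability zero. -/
def IsMultiple {N : ℕ} (φ χ : State N) : Prop := ∃ c : ℂ, φ = c • χ

/-- The product operators `S = ⨂ⱼ S⁽ʲ⁾` with invertible factors that fix the network state. -/
def IsLocalSymmetry {N : ℕ} [NeZero N] (S : Fin N → GL TwoQubit ℂ) : Prop :=
  applyLocal (fun j => (S j : LocalOp)) (networkState N) = networkState N

/-- Finite-round LOCC protocols. A protocol either stops, or some party `k` performs a generalized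
measurement with finitely many Kraus operators `M i`, broadcasts the outcome `i`, every other party
`j` applies the unitary `U i j`, and the protocol goes on with `next i`, which may depend on `i`.
(A unitary of party `k` itself is part of `M i`; the entry `U i k` is not used.) -/
inductive Protocol (N : ℕ) : Type
  | done : Protocol N
  | measure (k : Fin N) (m : ℕ) (M : Fin m → LocalOp)
      (complete : ∑ i, (M i)ᴴ * M i = 1)
      (U : Fin m → Fin N → Matrix.unitaryGroup TwoQubit ℂ)
      (next : Fin m → Protocol N) : Protocol N

/-- The product operator applied in one round when party `k` obtains an outcome with Kraus operator
`M` and the other parties apply the unitaries `U`. -/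
noncomputable def roundOp {N : ℕ} (k : Fin N) (M : LocalOp)
    (U : Fin N → Matrix.unitaryGroup TwoQubit ℂ) : Fin N → LocalOp :=
  Function.update (fun j => (U j : LocalOp)) k M

namespace Protocol

/-- The largest number of measurements that party `j` performs along a branch of the protocol. -/
def measurementCount {N : ℕ} (j : Fin N) : Protocol N → ℕ
  | done => 0
  | measure k _ _ _ _ next =>
      (if k = j then 1 else 0) + Finset.univ.sup fun i => (next i).measurementCount j

/-- Each party measures only once. -/
def EachPartyMeasuresOnce {N : ℕ} (P : Protocol N) : Prop :=
  ∀ j : Fin N, P.measurementCount j ≤ 1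

/-- Started in the state `φ`, every step of the protocol is a deterministic transformation among
pure states: in each round all outcomes lead to one and the same state `φ'` (up to a scalar). -/
def Deterministic {N : ℕ} : Protocol N → State N → Prop
  | done, _ => True
  | measure k _ M _ U next, φ =>
      (∃ φ' : State N, ∀ i, IsMultiple (applyLocal (roundOp k (M i) (U i)) φ) φ') ∧
        ∀ i, (next i).Deterministic (applyLocal (roundOp k (M i) (U i)) φ)

/-- Started in the state `φ`, the protocol ends in the state `χ` (up to a scalar) in all of its
branches. -/
def Reaches {N : ℕ} : Protocol N → State N → State N → Prop
  | done, φ, χ => IsMultiple φ χ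
  | measure k _ M _ U next, φ, χ =>
      ∀ i, (next i).Reaches (applyLocal (roundOp k (M i) (U i)) φ) χ

end Protocol

/-- The conditions for party `k` to transform, in a single round, the state with local operators
`h j` for `j ≠ k` and `g` for party `k`, where `gᴴ * g = G`, into the state `⨂ⱼ h j` applied to the
network state. With `H j = (h j)ᴴ * h j`, there are finitely many local symmetries `S i` and
probabilities `p i` such that each `S i` leaves `H j` invariant up to a factor for every `j ≠ k`, and
`∑ i, p i • (S i k)ᴴ * H k * S i k` is a real multiple of `G`. -/
def SingleRoundCondition {N : ℕ} [NeZero N] (h : Fin N → GL TwoQubit ℂ) (k : Fin N)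
    (G : LocalOp) : Prop :=
  ∃ (m : ℕ) (S : Fin m → Fin N → GL TwoQubit ℂ) (p : Fin m → ℝ),
    (∀ i, IsLocalSymmetry (S i)) ∧
    (∀ i, 0 ≤ p i) ∧ ∑ i, p i = 1 ∧
    (∀ i, ∀ j, j ≠ k → ∃ c : ℂ,
      (S i j : LocalOp)ᴴ * ((h j : LocalOp)ᴴ * (h j : LocalOp)) * (S i j : LocalOp) =
        c • ((h j : LocalOp)ᴴ * (h j : LocalOp))) ∧
    ∃ r : ℝ,
      ∑ i, (p i : ℂ) •
        ((S i k : LocalOp)ᴴ * ((h k : LocalOp)ᴴ * (h k : LocalOp)) * (S i k : LocalOp)) =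
        (r : ℂ) • G

end CycleNetwork

/-! Both directions rest on the local symmetries of the network state Ψ. For the singlet matrix σ,
`A σ Aᵀ = det A • σ`, so one determinant-one matrix placed on both qubits of an edge fixes Ψ
(`isLocalSymmetry_gauge`). Conversely, every factor of a local symmetry is a tensor product of two
one-qubit operators (`exists_kronecker_of_isLocalSymmetry`).

Necessity: follow a branch of non-zero probability to its final measurement, by party k. Since k
measures only once, its operator is unitary up to that point. By determinism every outcome gives a
multiple of hΨ, so the Kraus operators satisfy `M i * g k = c i • (h k * S i k)` with local
symmetries `S i`, and completeness says that the average of the `(S i k)ᴴ * H k * S i k` with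
weights |c i|² is the identity. Multiplying on the right by the inverse of one `S i₀` makes the
symmetries preserve all other `H j` and replaces the identity by the Gram matrix of a product
operator (`singleRoundCondition_of_last_round`).

Sufficiency: the single-round condition is itself a recipe for Kraus operators (`exists_round`). The
parties measure in the order k+1, …, k+N-1, k. Averaging over Pauli matrices on an edge whose other
end has not measured depolarizes the qubit on it. The first party depolarizes both qubits and so
implements any operator. Each later party before k depolarizes its second qubit; what remains to be
prepared is `A ⊗ 1`, which a symmetry of the preceding edge moves to the previous party, already
able to implement anything (`reachable_arc`). Likewise the `A ⊗ B` needed by k is moved to its two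
neighbours. -/

namespace CycleNetwork

/-! ### Product operators acting on states, and faithfulness of the action on the network state -/

section LocalOperators

variable {N : ℕ}

theorem applyLocal_applyLocal (A B : Fin N → LocalOp) (φ : State N) :
    applyLocal A (applyLocal B φ) = applyLocal (A * B) φ := by
  funext x
  simp only [applyLocal, Pi.mul_apply, Matrix.mul_apply, Finset.prod_univ_sum, Finset.mul_sum,
    Finset.sum_mul, Fintype.piFinset_univ]
  rw [Finset.sum_comm]
  refine Finset.sum_congr rfl fun y _ => Finset.sum_congr rfl fun z _ => ?_
  rw [Finset.prod_mul_distrib]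
  ring

theorem applyLocal_update_one (k : Fin N) (M : LocalOp) (φ : State N) (x : Fin N → TwoQubit) :
    applyLocal (Function.update 1 k M) φ x = ∑ p, M (x k) p * φ (Function.update x k p) := by
  symm
  refine Fintype.sum_of_injective (fun p => Function.update x k p)
    (Function.update_injective x k) _ _ ?_ ?_
  · intro y hy
    have : ∃ j, j ≠ k ∧ x j ≠ y j := by
      by_contra! hc
      refine hy ⟨y k, ?_⟩
      funext j
      by_cases hj : j = k
      · subst hj; simp
      · simp [hj, hc j hj]
    obtain ⟨j, hj, hxy⟩ := this
    rw [Finset.prod_eq_zero (Finset.mem_univ j), zero_mul]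
    simp [Function.update_of_ne hj, Matrix.one_apply_ne hxy]
  · intro p
    rw [Finset.prod_eq_single k]
    · simp
    · intro j _ hj
      simp [Function.update_of_ne hj]
    · simp

theorem applyLocal_one (φ : State N) : applyLocal 1 φ = φ := by
  funext x
  rw [applyLocal, Finset.sum_eq_single x]
  · simp
  · intro y _ hy
    obtain ⟨j, hj⟩ := Function.ne_iff.mp hy
    rw [Finset.prod_eq_zero (Finset.mem_univ j), zero_mul]
    simp [Matrix.one_apply_ne hj.symm]
  · simp

theorem applyLocal_smul (A : Fin N → LocalOp) (c : ℂ) (φ : State N) :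
    applyLocal A (c • φ) = c • applyLocal A φ := by
  funext x
  simp only [applyLocal, Pi.smul_apply, smul_eq_mul, Finset.mul_sum]
  exact Finset.sum_congr rfl fun y _ => by ring

theorem applyLocal_zero (A : Fin N → LocalOp) : applyLocal A (0 : State N) = 0 := by
  funext x; simp [applyLocal]

theorem applyLocal_smul_ops (c : Fin N → ℂ) (A : Fin N → LocalOp) (φ : State N) :
    applyLocal (fun j => c j • A j) φ = (∏ j, c j) • applyLocal A φ := by
  funext x
  simp only [applyLocal, Pi.smul_apply, smul_eq_mul, Finset.mul_sum, Matrix.smul_apply,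
    Finset.prod_mul_distrib]
  exact Finset.sum_congr rfl fun y _ => by ring

theorem applyLocal_update_update_one {k l : Fin N} (hkl : l ≠ k) (X Y : LocalOp) (φ : State N)
    (x : Fin N → TwoQubit) :
    applyLocal (Function.update (Function.update (1 : Fin N → LocalOp) k X) l Y) φ x =
      ∑ p, ∑ q, X (x k) p * Y (x l) q * φ (Function.update (Function.update x k p) l q) := by
  have : (Function.update (Function.update (1 : Fin N → LocalOp) k X) l Y : Fin N → LocalOp) =
      Function.update (1 : Fin N → LocalOp) k X * Function.update (1 : Fin N → LocalOp) l Y := by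
    funext j
    by_cases hl : j = l
    · subst hl; simp [hkl]
    · by_cases hk : j = k
      · subst hk; simp [hl]
      · simp [hl, hk]
  rw [this, ← applyLocal_applyLocal, applyLocal_update_one]
  refine Finset.sum_congr rfl fun p _ => ?_
  rw [applyLocal_update_one, Finset.mul_sum]
  refine Finset.sum_congr rfl fun q _ => ?_
  rw [Function.update_of_ne hkl, mul_assoc]

/-- The matrices underlying a family of invertible operators. -/
def toOps (g : Fin N → GL TwoQubit ℂ) : Fin N → LocalOp := fun j => (g j : LocalOp)

theorem toOps_mul (g h : Fin N → GL TwoQubit ℂ) : toOps (g * h) = toOps g * toOps h := rfl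

theorem toOps_one : toOps (1 : Fin N → GL TwoQubit ℂ) = 1 := rfl

theorem applyLocal_toOps_mul (g h : Fin N → GL TwoQubit ℂ) (φ : State N) :
    applyLocal (toOps (g * h)) φ = applyLocal (toOps g) (applyLocal (toOps h) φ) := by
  rw [toOps_mul, applyLocal_applyLocal]

theorem applyLocal_toOps_injective (g : Fin N → GL TwoQubit ℂ) :
    Function.Injective (applyLocal (toOps g)) := by
  refine Function.LeftInverse.injective (g := applyLocal (toOps g⁻¹)) fun φ => ?_
  rw [← applyLocal_toOps_mul, inv_mul_cancel, toOps_one, applyLocal_one]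

variable [NeZero N]

theorem IsLocalSymmetry.mul {S T : Fin N → GL TwoQubit ℂ} (hS : IsLocalSymmetry S)
    (hT : IsLocalSymmetry T) : IsLocalSymmetry (S * T) := by
  change applyLocal (toOps (S * T)) _ = _
  rw [applyLocal_toOps_mul]
  exact (congrArg _ hT).trans hS

theorem IsLocalSymmetry.inv {S : Fin N → GL TwoQubit ℂ} (hS : IsLocalSymmetry S) :
    IsLocalSymmetry S⁻¹ := by
  apply applyLocal_toOps_injective S
  change applyLocal (toOps S) (applyLocal (toOps S⁻¹) _) = applyLocal (toOps S) _
  rw [← applyLocal_toOps_mul, mul_inv_cancel, toOps_one, applyLocal_one]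
  exact hS.symm

theorem isLocalSymmetry_one : IsLocalSymmetry (1 : Fin N → GL TwoQubit ℂ) :=
  applyLocal_one _

theorem IsLocalSymmetry.applyLocal_mul {S : Fin N → GL TwoQubit ℂ} (hS : IsLocalSymmetry S)
    (g : Fin N → GL TwoQubit ℂ) :
    applyLocal (toOps (g * S)) (networkState N) = applyLocal (toOps g) (networkState N) := by
  rw [applyLocal_toOps_mul]
  exact congrArg _ hS

/-! ### The singlet -/

theorem inv_sqrt_two_ne_zero : ((1 / √2 : ℝ) : ℂ) ≠ 0 := by
  norm_num

theorem singlet_eq_zero_iff (b c : Fin 2) : singlet b c = 0 ↔ b = c := by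
  have := inv_sqrt_two_ne_zero
  fin_cases b <;> fin_cases c <;> simp [singlet]

theorem isUnit_singlet_det : IsUnit singlet.det := by
  have := inv_sqrt_two_ne_zero
  rw [isUnit_iff_ne_zero, Matrix.det_fin_two, singlet]
  simp

theorem specialLinear_mul_singlet (A : Matrix.SpecialLinearGroup (Fin 2) ℂ) :
    (A : Matrix (Fin 2) (Fin 2) ℂ) * singlet * (A : Matrix (Fin 2) (Fin 2) ℂ)ᵀ = singlet := by
  have hA := A.det_coe
  rw [Matrix.det_fin_two] at hA
  set s := ((1 / √2 : ℝ) : ℂ) with hs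
  ext i j
  simp only [Matrix.mul_apply, Fin.sum_univ_two, Matrix.transpose_apply, singlet]
  rw [← hs]
  fin_cases i <;> fin_cases j <;> simp
  · ring
  · linear_combination s * hA
  · linear_combination (-s) * hA
  · ring

/-- A basis label of the other parties which gives non-zero amplitude exactly when the left qubit of
`l` is `a` and the right qubit of `m` is `d`. -/
def complementLabel (l m : Fin N) (a d : Fin 2) : Fin N → TwoQubit :=
  fun i => (if i = m + 1 then 1 - d else 0, if i + 1 = l then 1 - a else 1)

theorem one_sub_eq_iff (a b : Fin 2) : 1 - a = b ↔ b ≠ a := by decide +revert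

/-- Fixing the other labels singles out one label of party `j`, so single matrix entries of an
operator at `j` can be read off its action on the network state. -/
theorem networkState_update_complementLabel (j : Fin N) (hN : j + 1 ≠ j) (p q : TwoQubit) :
    networkState N (Function.update (complementLabel j j p.1 p.2) j q) = 0 ↔ q ≠ p := by
  rw [networkState, Finset.prod_eq_zero_iff]
  simp only [Finset.mem_univ, true_and, singlet_eq_zero_iff]
  constructor
  · rintro ⟨i, hi⟩ rfl
    by_cases h1 : i = j
    · subst h1
      rw [Function.update_self, Function.update_of_ne hN] at hi
      simp only [complementLabel, if_true] at hi
      exact (one_sub_eq_iff _ _).mp hi.symm rfl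
    · rw [Function.update_of_ne h1] at hi
      by_cases h2 : i + 1 = j
      · rw [h2, Function.update_self] at hi
        simp only [complementLabel, h2, if_true] at hi
        exact (one_sub_eq_iff _ _).mp hi rfl
      · rw [Function.update_of_ne h2] at hi
        simp [complementLabel, h1, h2] at hi
  · intro h
    by_cases h2 : q.2 = p.2
    · have h1 : q.1 ≠ p.1 := fun h1 => h (Prod.ext h1 h2)
      refine ⟨j - 1, ?_⟩
      have : j - 1 ≠ j := fun h' => hN (by nth_rw 1 [← h']; simp)
      simp [Function.update_of_ne this, complementLabel, (one_sub_eq_iff _ _).mpr h1]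
    · refine ⟨j, ?_⟩
      simp [Function.update_of_ne hN, complementLabel, (one_sub_eq_iff _ _).mpr h2]

theorem eq_zero_of_applyLocal_update_eq_zero {j : Fin N} (hN : j + 1 ≠ j) {E : LocalOp}
    (hE : applyLocal (Function.update 1 j E) (networkState N) = 0) : E = 0 := by
  ext q p
  have h := congrFun hE (Function.update (complementLabel j j p.1 p.2) j q)
  rw [applyLocal_update_one, Finset.sum_eq_single p] at h
  · simp only [Function.update_self, Function.update_idem, Pi.zero_apply, mul_eq_zero,
      networkState_update_complementLabel j hN, ne_eq, not_true_eq_false, or_false] at h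
    exact h
  · intro r _ hr
    rw [Function.update_idem, (networkState_update_complementLabel j hN p r).mpr hr, mul_zero]
  · simp

/-- A singular `L j` has a non-zero left annihilator `E`. Applied at `j`, it would kill the state
with operators `h`, and faithfulness then gives `E * h j = 0`, hence `E = 0`. -/
theorem isUnit_of_applyLocal_eq_smul {j : Fin N} (hN : j + 1 ≠ j) {L : Fin N → LocalOp}
    {h : Fin N → GL TwoQubit ℂ} {c : ℂ} (hc : c ≠ 0)
    (hL : applyLocal L (networkState N) = c • applyLocal (toOps h) (networkState N)) :
    IsUnit (L j) := by
  by_contra hj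
  rw [Matrix.isUnit_iff_isUnit_det, isUnit_iff_ne_zero, not_not] at hj
  obtain ⟨v, hv, hvL⟩ := Matrix.exists_vecMul_eq_zero_iff.mpr hj
  -- Every row of `E` is the left null vector `v`.
  set E : LocalOp := Matrix.vecMulVec 1 v
  have hEL : E * L j = 0 := by
    ext p q
    have := congrFun hvL q
    simpa [E, Matrix.mul_apply, Matrix.vecMulVec_apply, Matrix.vecMul, dotProduct] using this
  have h0 : applyLocal (Function.update 1 j E) (applyLocal L (networkState N)) = 0 := by
    funext x
    rw [applyLocal_applyLocal]
    simp only [applyLocal, Pi.zero_apply]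
    refine Finset.sum_eq_zero fun y _ => ?_
    rw [Finset.prod_eq_zero (Finset.mem_univ j), zero_mul]
    simp [hEL]
  rw [hL, applyLocal_smul, smul_eq_zero_iff_right hc] at h0
  have h1 : applyLocal (Function.update 1 j (E * h j)) (networkState N) = 0 := by
    apply applyLocal_toOps_injective (Function.update h j 1)
    rw [applyLocal_zero, applyLocal_applyLocal, ← h0, applyLocal_applyLocal]
    congr 1
    funext i
    by_cases hi : i = j
    · subst hi; simp [toOps]
    · simp [toOps, hi]
  have h2 := eq_zero_of_applyLocal_update_eq_zero hN h1
  have h3 : E = 0 := by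
    have := congrArg (· * ((h j)⁻¹ : GL TwoQubit ℂ).val) h2
    simpa [mul_assoc] using this
  apply hv
  funext q
  have := congrFun (congrFun h3 0) q
  simpa [E, Matrix.vecMulVec_apply] using this

end LocalOperators

/-! ### The local symmetries of the network state -/

section Symmetries

variable {N : ℕ}

/-! ### Product symmetries -/

/-- The invertible product operator `A ⊗ B` of two matrices of determinant one. -/
noncomputable def kronGL (A B : Matrix.SpecialLinearGroup (Fin 2) ℂ) : GL TwoQubit ℂ where
  val := (A : Matrix (Fin 2) (Fin 2) ℂ) ⊗ₖ (B : Matrix (Fin 2) (Fin 2) ℂ)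
  inv := ((A⁻¹ : Matrix.SpecialLinearGroup (Fin 2) ℂ) : Matrix (Fin 2) (Fin 2) ℂ) ⊗ₖ
    ((B⁻¹ : Matrix.SpecialLinearGroup (Fin 2) ℂ) : Matrix (Fin 2) (Fin 2) ℂ)
  val_inv := by
    rw [← Matrix.mul_kronecker_mul, ← Matrix.SpecialLinearGroup.coe_mul,
      ← Matrix.SpecialLinearGroup.coe_mul, mul_inv_cancel, mul_inv_cancel]
    simp
  inv_val := by
    rw [← Matrix.mul_kronecker_mul, ← Matrix.SpecialLinearGroup.coe_mul,
      ← Matrix.SpecialLinearGroup.coe_mul, inv_mul_cancel, inv_mul_cancel]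
    simp

theorem coe_kronGL (A B : Matrix.SpecialLinearGroup (Fin 2) ℂ) :
    (kronGL A B : LocalOp) =
      (A : Matrix (Fin 2) (Fin 2) ℂ) ⊗ₖ (B : Matrix (Fin 2) (Fin 2) ℂ) := rfl

theorem kronGL_mul (A B C D : Matrix.SpecialLinearGroup (Fin 2) ℂ) :
    kronGL A B * kronGL C D = kronGL (A * C) (B * D) := by
  apply Units.ext
  simp only [Units.val_mul, coe_kronGL, Matrix.SpecialLinearGroup.coe_mul,
    Matrix.mul_kronecker_mul]

theorem kronGL_one : kronGL 1 1 = 1 := by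
  apply Units.ext
  simp [coe_kronGL]

variable [NeZero N]

/-- The product operator acting with `a j` on both qubits of the edge between `j - 1` and `j`. -/
noncomputable def gauge (a : Fin N → Matrix.SpecialLinearGroup (Fin 2) ℂ) :
    Fin N → GL TwoQubit ℂ :=
  fun j => kronGL (a j) (a (j + 1))

/-- Reading a basis label edge by edge instead of party by party. -/
def edgeEquiv (N : ℕ) [NeZero N] : (Fin N → TwoQubit) ≃ (Fin N → TwoQubit) where
  toFun y j := ((y j).2, (y (j + 1)).1)
  invFun w j := ((w (j - 1)).2, (w j).1)
  left_inv y := by funext j; simp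
  right_inv w := by funext j; simp

/-- Regrouped by edges, the sum over basis labels factorizes, and each edge contributes `A * singlet
* Aᵀ = singlet`. -/
theorem isLocalSymmetry_gauge (a : Fin N → Matrix.SpecialLinearGroup (Fin 2) ℂ) :
    IsLocalSymmetry (gauge a) := by
  funext x
  let G : Fin N → TwoQubit → ℂ := fun j w =>
    (a (j + 1)).1 (x j).2 w.1 * singlet w.1 w.2 * (a (j + 1)).1 (x (j + 1)).1 w.2
  have h1 : ∀ y : Fin N → TwoQubit,
      (∏ j, (gauge a j : LocalOp) (x j) (y j)) * networkState N y =
        ∏ j, G j (edgeEquiv N y j) := by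
    intro y
    have hs : ∏ j, (a j).1 (x j).1 (y j).1 = ∏ j, (a (j + 1)).1 (x (j + 1)).1 (y (j + 1)).1 :=
      (Equiv.prod_comp (Equiv.addRight (1 : Fin N)) fun j => (a j).1 (x j).1 (y j).1).symm
    simp only [gauge, coe_kronGL, Matrix.kroneckerMap_apply, networkState, G, edgeEquiv,
      Equiv.coe_fn_mk, Finset.prod_mul_distrib]
    rw [hs]
    ring
  have h2 : ∀ j, ∑ w, G j w = singlet (x j).2 (x (j + 1)).1 := by
    intro j
    conv_rhs => rw [← specialLinear_mul_singlet (a (j + 1))]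
    simp only [G, Fintype.sum_prod_type, Matrix.mul_apply, Matrix.transpose_apply,
      Finset.sum_mul]
    exact Finset.sum_comm
  rw [applyLocal, Finset.sum_congr rfl fun y _ => h1 y,
    Equiv.sum_comp (edgeEquiv N) fun w => ∏ j, G j (w j), networkState,
    Finset.prod_congr rfl fun j _ => (h2 j).symm, Finset.prod_univ_sum, Fintype.piFinset_univ]

theorem gauge_update_one_eq {k : Fin N} (hk : k + 1 ≠ k)
    (A : Matrix.SpecialLinearGroup (Fin 2) ℂ) :
    gauge (Function.update 1 (k + 1) A) =
      Function.update (Function.update (1 : Fin N → GL TwoQubit ℂ) k (kronGL 1 A)) (k + 1) (kronGL A 1) := by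
  have h2 : k + 1 + 1 ≠ k + 1 := fun h => hk (add_right_cancel h)
  funext j
  by_cases h1 : j = k + 1
  · subst h1; simp [gauge, h2]
  · by_cases h0 : j = k
    · subst h0; simp [gauge, hk.symm]
    · simp [gauge, h0, h1, kronGL_one]

/-! ### Every local symmetry is a product -/

/-- Two test matrices suffice: diag(i, -i) kills the diagonal of `F`, and the rotation by a right
angle makes the off-diagonal entries opposite. -/
theorem eq_smul_singlet_of_invariant {F : Matrix (Fin 2) (Fin 2) ℂ}
    (hF : ∀ A : Matrix.SpecialLinearGroup (Fin 2) ℂ, A.1 * F * A.1ᵀ = F) :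
    ∃ t : ℂ, F = t • singlet := by
  have h1 := hF ⟨!![Complex.I, 0; 0, -Complex.I], by simp [Matrix.det_fin_two]⟩
  have h2 := hF ⟨!![0, 1; -1, 0], by simp [Matrix.det_fin_two]⟩
  have h00 := congrFun (congrFun h1 0) 0
  have h11 := congrFun (congrFun h1 1) 1
  have h01 := congrFun (congrFun h2 1) 0
  simp only [Matrix.mul_apply, Fin.sum_univ_two, Matrix.transpose_apply] at h00 h11 h01
  simp at h00 h11 h01
  have hI : Complex.I * Complex.I = -1 := Complex.I_mul_I
  have e00 : F 0 0 = 0 := by linear_combination (-1 / 2 : ℂ) * h00 + (1 / 2 : ℂ) * F 0 0 * hI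
  have e11 : F 1 1 = 0 := by linear_combination (-1 / 2 : ℂ) * h11 + (1 / 2 : ℂ) * F 1 1 * hI
  have hs := inv_sqrt_two_ne_zero
  refine ⟨F 0 1 / ((1 / √2 : ℝ) : ℂ), ?_⟩
  ext i j
  fin_cases i <;> fin_cases j
  · simp [singlet, e00]
  · simp only [singlet, Matrix.smul_apply, smul_eq_mul]
    exact (div_mul_cancel₀ _ hs).symm
  · simp only [singlet, Matrix.smul_apply, smul_eq_mul]
    change F 1 0 = _ * -_
    rw [mul_neg, div_mul_cancel₀ _ hs, h01]
  · simp [singlet, e11]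

/-- The block of a two-qubit operator with the labels of the first qubit fixed. -/
def rightBlock (X : LocalOp) (a' a : Fin 2) : Matrix (Fin 2) (Fin 2) ℂ :=
  Matrix.of fun b' b => X (a', b') (a, b)

/-- The block of a two-qubit operator with the labels of the second qubit fixed. -/
def leftBlock (Y : LocalOp) (d' d : Fin 2) : Matrix (Fin 2) (Fin 2) ℂ :=
  Matrix.of fun c' c => Y (c', d') (c, d)

/-- Conjugating by the singlet turns the hypothesis into: each block of `X` times each `Z d' d` is
scalar. One such product is non-zero, so that `Z d' d` is invertible and all blocks of `X` are
multiples of its inverse. -/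
theorem exists_kronecker_of_blocks {X Y : LocalOp} (hX : IsUnit X) (hY : IsUnit Y)
    (h : ∀ a' a d' d, ∃ c : ℂ,
      rightBlock X a' a * singlet * (leftBlock Y d' d)ᵀ = c • singlet) :
    ∃ P Q : Matrix (Fin 2) (Fin 2) ℂ, X = P ⊗ₖ Q := by
  have hsd := isUnit_singlet_det
  have hss : singlet * singlet⁻¹ = 1 := Matrix.mul_nonsing_inv _ hsd
  set Z : Fin 2 → Fin 2 → Matrix (Fin 2) (Fin 2) ℂ := fun d' d =>
    singlet * (leftBlock Y d' d)ᵀ * singlet⁻¹ with hZ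
  have hc : ∀ a' a d' d, ∃ c : ℂ, rightBlock X a' a * Z d' d = c • 1 := by
    intro a' a d' d
    obtain ⟨c, hc⟩ := h a' a d' d
    refine ⟨c, ?_⟩
    rw [hZ]
    simp only [← mul_assoc]
    rw [hc, Matrix.smul_mul, hss]
  have hZ0 : ∃ d' d, Z d' d ≠ 0 := by
    by_contra! h0
    have : Y = 0 := by
      ext ⟨c', d'⟩ ⟨c, d⟩
      have h1 : leftBlock Y d' d = 0 := by
        have h2 : singlet⁻¹ * Z d' d * singlet = 0 := by rw [h0]; simp
        simp only [hZ, mul_assoc] at h2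
        rw [Matrix.nonsing_inv_mul _ hsd, mul_one, ← mul_assoc, Matrix.nonsing_inv_mul _ hsd,
          one_mul, Matrix.transpose_eq_zero] at h2
        exact h2
      exact congrFun (congrFun h1 c') c
    exact not_isUnit_zero (this ▸ hY)
  obtain ⟨d', d, hd⟩ := hZ0
  by_cases hall : ∀ a' a, rightBlock X a' a * Z d' d = 0
  · exfalso
    obtain ⟨i, w, hw⟩ : ∃ i w, Z d' d i w ≠ 0 := by
      by_contra! h0
      exact hd (by ext i j; exact h0 i j)
    -- If all products vanished, a non-zero column of `Z d' d` would yield a kernel vector of `X`.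
    have hv : X *ᵥ (fun p => if p.1 = 0 then Z d' d p.2 w else 0) = 0 := by
      funext ⟨a', b'⟩
      have := congrFun (congrFun (hall a' 0) b') w
      simpa [Matrix.mulVec, dotProduct, Fintype.sum_prod_type, Matrix.mul_apply, rightBlock]
        using this
    have h0 := Matrix.mulVec_injective_of_isUnit hX (hv.trans (Matrix.mulVec_zero X).symm)
    apply hw
    simpa using congrFun h0 (0, i)
  · push Not at hall
    obtain ⟨a₁, a₀, ha⟩ := hall
    obtain ⟨c, hc1⟩ := hc a₁ a₀ d' d
    have hc0 : c ≠ 0 := by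
      rintro rfl
      exact ha (by rw [hc1, zero_smul])
    have hinv : Z d' d * (c⁻¹ • rightBlock X a₁ a₀) = 1 := by
      apply mul_eq_one_comm.mp
      rw [Matrix.smul_mul, hc1, smul_smul, inv_mul_cancel₀ hc0, one_smul]
    choose e he using fun a' a => hc a' a d' d
    refine ⟨Matrix.of e, c⁻¹ • rightBlock X a₁ a₀, ?_⟩
    ext ⟨a', b'⟩ ⟨a, b⟩
    have : rightBlock X a' a = e a' a • (c⁻¹ • rightBlock X a₁ a₀) := by
      calc rightBlock X a' a = rightBlock X a' a * (Z d' d * (c⁻¹ • rightBlock X a₁ a₀)) := by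
            rw [hinv, mul_one]
        _ = _ := by rw [← mul_assoc, he, Matrix.smul_mul, one_mul]
    exact congrFun (congrFun this b') b

/-- The product of the amplitudes of all edges but the one between `k` and `k + 1`. -/
noncomputable def restAmplitude (k : Fin N) (y : Fin N → TwoQubit) : ℂ :=
  ∏ i ∈ Finset.univ.erase k, singlet (y i).2 (y (i + 1)).1

theorem networkState_eq_mul_restAmplitude (k : Fin N) (y : Fin N → TwoQubit) :
    networkState N y = singlet (y k).2 (y (k + 1)).1 * restAmplitude k y :=
  (Finset.mul_prod_erase _ _ (Finset.mem_univ k)).symm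

theorem restAmplitude_update {k : Fin N} (h1 : k + 1 ≠ k) (x : Fin N → TwoQubit)
    (a b b' c c' d : Fin 2) :
    restAmplitude k (Function.update (Function.update x k (a, b)) (k + 1) (c, d)) =
      restAmplitude k (Function.update (Function.update x k (a, b')) (k + 1) (c', d)) := by
  refine Finset.prod_congr rfl fun i hi => ?_
  have hik : i ≠ k := Finset.ne_of_mem_erase hi
  have hik1 : i + 1 ≠ k + 1 := fun h => hik (add_right_cancel h)
  congr 1
  · by_cases h : i = k + 1
    · subst h; simp
    · simp [h, hik]
  · by_cases h : i + 1 = k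
    · simp [h, h1.symm]
    · simp [h, hik1]

theorem restAmplitude_complementLabel {k : Fin N} (h1 : k + 1 ≠ k) (h2 : k + 1 + 1 ≠ k)
    (a d : Fin 2) (p q : TwoQubit) :
    restAmplitude k (Function.update (Function.update (complementLabel k (k + 1) a d) k p)
      (k + 1) q) = 0 ↔ ¬ (p.1 = a ∧ q.2 = d) := by
  have h3 : k + 1 + 1 ≠ k + 1 := fun h => h1 (add_right_cancel h)
  rw [restAmplitude, Finset.prod_eq_zero_iff]
  simp only [singlet_eq_zero_iff, Finset.mem_erase, Finset.mem_univ, and_true]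
  constructor
  · rintro ⟨i, hik, hi⟩ ⟨rfl, rfl⟩
    have hik1 : i + 1 ≠ k + 1 := fun h => hik (add_right_cancel h)
    by_cases h : i = k + 1
    · subst h
      simp only [Function.update_self, Function.update_of_ne h3, Function.update_of_ne h2,
        complementLabel, if_true] at hi
      exact (one_sub_eq_iff _ _).mp hi.symm rfl
    · by_cases h' : i + 1 = k
      · rw [h'] at hi
        simp only [Function.update_self, Function.update_of_ne h1.symm, Function.update_of_ne h,
          Function.update_of_ne hik, complementLabel, h', if_true] at hi
        exact (one_sub_eq_iff _ _).mp hi rfl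
      · simp [Function.update_of_ne hik, complementLabel, h, h', hik1] at hi
  · intro h
    by_cases hd : q.2 = d
    · have ha : p.1 ≠ a := fun ha => h ⟨ha, hd⟩
      have e1 : k - 1 ≠ k := fun h' => h1 (by nth_rw 1 [← h']; simp)
      have e2 : k - 1 ≠ k + 1 := fun h' => h2 (by rw [← h']; simp)
      refine ⟨k - 1, e1, ?_⟩
      simp [Function.update_of_ne e1, Function.update_of_ne e2, Function.update_of_ne h1.symm,
        complementLabel, (one_sub_eq_iff _ _).mpr ha]
    · refine ⟨k + 1, h1, ?_⟩
      simp [Function.update_of_ne h2, Function.update_of_ne h3, complementLabel,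
        (one_sub_eq_iff _ _).mpr hd]

/-- The complementary label pins the outer input qubits of the pair to `a` and `d`, so only the
singlet on the shared edge is summed over. -/
theorem applyLocal_pair_networkState {k : Fin N} (h1 : k + 1 ≠ k) (h2 : k + 1 + 1 ≠ k)
    (X Y : LocalOp) (a d : Fin 2) :
    ∃ K : ℂ, K ≠ 0 ∧ ∀ a' b' c' d',
      applyLocal (Function.update (Function.update 1 k X) (k + 1) Y) (networkState N)
        (Function.update (Function.update (complementLabel k (k + 1) a d) k (a', b'))
          (k + 1) (c', d')) =
        K * (rightBlock X a' a * singlet * (leftBlock Y d' d)ᵀ) b' c' := by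
  set z := complementLabel k (k + 1) a d with hz
  refine ⟨restAmplitude k (Function.update (Function.update z k (a, 0)) (k + 1) (0, d)), ?_, ?_⟩
  · rw [Ne, restAmplitude_complementLabel h1 h2]; simp
  intro a' b' c' d'
  rw [applyLocal_update_update_one h1]
  have hup : ∀ p q : TwoQubit,
      Function.update (Function.update (Function.update (Function.update z k (a', b'))
        (k + 1) (c', d')) k p) (k + 1) q = Function.update (Function.update z k p) (k + 1) q := by
    intro p q
    rw [Function.update_comm h1, Function.update_idem, Function.update_idem]
  have hamp : ∀ p q : TwoQubit,
      networkState N (Function.update (Function.update z k p) (k + 1) q) =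
        if p.1 = a ∧ q.2 = d then singlet p.2 q.1 *
          restAmplitude k (Function.update (Function.update z k (a, 0)) (k + 1) (0, d)) else 0 := by
    rintro ⟨p1, p2⟩ ⟨q1, q2⟩
    rw [networkState_eq_mul_restAmplitude k]
    split_ifs with h
    · obtain ⟨rfl, rfl⟩ := h
      rw [restAmplitude_update h1 z p1 p2 0 q1 0 q2]
      simp [h1.symm]
    · rw [(restAmplitude_complementLabel h1 h2 a d _ _).mpr h, mul_zero]
  simp only [hup, hamp, Function.update_self, Function.update_of_ne h1.symm, Matrix.mul_apply,
    Fintype.sum_prod_type, Matrix.transpose_apply, rightBlock, leftBlock, Matrix.of_apply]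
  generalize restAmplitude k _ = K
  fin_cases a <;> fin_cases d <;> simp [Fin.sum_univ_two] <;> ring

open scoped Fin.CommRing in
theorem natCast_fin_ne_zero {t : ℕ} (h0 : t ≠ 0) (ht : t < N) : (t : Fin N) ≠ 0 := by
  rw [Ne, Fin.natCast_eq_zero]
  exact Nat.not_dvd_of_pos_of_lt (Nat.pos_of_ne_zero h0) ht

open scoped Fin.CommRing in
theorem add_one_ne_self (hN : 2 ≤ N) (k : Fin N) : k + 1 ≠ k := by
  have := natCast_fin_ne_zero (N := N) one_ne_zero (by omega)
  rw [Nat.cast_one] at this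
  simpa using this

open scoped Fin.CommRing in
theorem add_one_add_one_ne_self (hN : 3 ≤ N) (k : Fin N) : k + 1 + 1 ≠ k := by
  have := natCast_fin_ne_zero (N := N) two_ne_zero (by omega)
  rw [Nat.cast_two] at this
  rw [add_assoc, one_add_one_eq_two]
  simpa using this

/-- Acting with `S` only at `k` and `k + 1` is the same as acting with `S⁻¹` at all other parties.
The latter commutes with the gauge symmetries of the edge between `k` and `k + 1`, so the amplitudes
on that edge remain proportional to the singlet, as `exists_kronecker_of_blocks` requires. -/
theorem exists_kronecker_of_isLocalSymmetry (hN : 3 ≤ N) {S : Fin N → GL TwoQubit ℂ}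
    (hS : IsLocalSymmetry S) (k : Fin N) :
    ∃ P Q : Matrix (Fin 2) (Fin 2) ℂ, (S k : LocalOp) = P ⊗ₖ Q := by
  have h1 := add_one_ne_self (show 2 ≤ N by omega) k
  have h2 := add_one_add_one_ne_self hN k
  refine exists_kronecker_of_blocks (Y := S (k + 1)) (S k).isUnit (S (k + 1)).isUnit ?_
  intro a' a d' d
  set R : Fin N → GL TwoQubit ℂ := Function.update (Function.update S⁻¹ k 1) (k + 1) 1 with hR
  set f := applyLocal (Function.update (Function.update 1 k (S k : LocalOp)) (k + 1)
    (S (k + 1) : LocalOp)) (networkState N) with hf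
  have hfR : f = applyLocal (toOps R) (networkState N) := by
    have : applyLocal (toOps S) (networkState N) = networkState N := hS
    rw [← this, applyLocal_applyLocal, hf]
    congr 1
    funext j
    by_cases e1 : j = k + 1
    · subst e1; simp [hR, toOps]
    · by_cases e0 : j = k
      · subst e0; simp [hR, toOps, h1.symm]
      · simp [hR, toOps, e0, e1]
  have hinv : ∀ A : Matrix.SpecialLinearGroup (Fin 2) ℂ,
      applyLocal (Function.update (Function.update (1 : Fin N → LocalOp) k (kronGL 1 A : LocalOp)) (k + 1)
        (kronGL A 1 : LocalOp)) f = f := by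
    intro A
    have h3 : (Function.update (Function.update (1 : Fin N → LocalOp) k (kronGL 1 A : LocalOp)) (k + 1)
        (kronGL A 1 : LocalOp)) = toOps (gauge (Function.update 1 (k + 1) A)) := by
      rw [gauge_update_one_eq h1]
      funext j
      by_cases e1 : j = k + 1
      · subst e1; simp [toOps]
      · by_cases e0 : j = k
        · subst e0; simp [toOps, e1]
        · simp [toOps, e0, e1]
    rw [h3, hfR, ← applyLocal_toOps_mul]
    have hcomm : gauge (Function.update 1 (k + 1) A) * R =
        R * gauge (Function.update 1 (k + 1) A) := by
      rw [gauge_update_one_eq h1]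
      funext j
      by_cases e1 : j = k + 1
      · subst e1; simp [hR]
      · by_cases e0 : j = k
        · subst e0; simp [hR, e1]
        · simp [hR, e0, e1]
    rw [hcomm, (isLocalSymmetry_gauge _).applyLocal_mul]
  obtain ⟨K, hK, hKf⟩ := applyLocal_pair_networkState h1 h2 (S k : LocalOp) (S (k + 1)) a d
  rw [← hf] at hKf
  obtain ⟨t, ht⟩ := eq_smul_singlet_of_invariant
    (F := Matrix.of fun b c => f (Function.update (Function.update
      (complementLabel k (k + 1) a d) k (a', b)) (k + 1) (c, d'))) (by
      intro A
      ext b c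
      have h4 := congrFun (hinv A) (Function.update (Function.update
        (complementLabel k (k + 1) a d) k (a', b)) (k + 1) (c, d'))
      rw [applyLocal_update_update_one h1] at h4
      rw [Matrix.of_apply, ← h4]
      have hup : ∀ p q : TwoQubit,
          Function.update (Function.update (Function.update (Function.update
            (complementLabel k (k + 1) a d) k (a', b)) (k + 1) (c, d')) k p) (k + 1) q =
          Function.update (Function.update (complementLabel k (k + 1) a d) k p) (k + 1) q := by
        intro p q
        rw [Function.update_comm h1, Function.update_idem, Function.update_idem]
      simp only [hup, Function.update_self, Function.update_of_ne h1.symm, coe_kronGL,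
        Matrix.kroneckerMap_apply, Matrix.mul_apply, Matrix.of_apply, Matrix.transpose_apply,
        Fintype.sum_prod_type, Matrix.SpecialLinearGroup.coe_one, Matrix.one_apply]
      fin_cases a' <;> fin_cases d' <;> simp [Fin.sum_univ_two] <;> ring)
  refine ⟨K⁻¹ * t, ?_⟩
  ext b c
  have h5 := congrFun (congrFun ht b) c
  rw [Matrix.of_apply, hKf, Matrix.smul_apply, smul_eq_mul] at h5
  rw [Matrix.smul_apply, smul_eq_mul, mul_assoc K⁻¹, ← h5, inv_mul_cancel_left₀ hK]

end Symmetries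

/-! ### Composition of protocols, Gram matrices and Pauli averages -/

section Protocols

variable {N : ℕ}

namespace Protocol

/-- Run the protocol `Q` after every branch of the protocol `P`. -/
def append : Protocol N → Protocol N → Protocol N
  | done, Q => Q
  | measure k m M complete U next, Q => measure k m M complete U fun i => (next i).append Q

theorem measurementCount_append_le (j : Fin N) (P Q : Protocol N) :
    (P.append Q).measurementCount j ≤ P.measurementCount j + Q.measurementCount j := by
  induction P with
  | done => simp [append, measurementCount]
  | measure k m M complete U next ih =>
    simp only [append, measurementCount, add_assoc]
    refine Nat.add_le_add_left (Finset.sup_le fun i _ => (ih i).trans ?_) _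
    exact Nat.add_le_add_right
      (Finset.le_sup (f := fun i => (next i).measurementCount j) (Finset.mem_univ i)) _

theorem Reaches.smul {P : Protocol N} {φ χ : State N} (h : P.Reaches φ χ) (c : ℂ) :
    P.Reaches (c • φ) χ := by
  induction P generalizing φ with
  | done =>
    obtain ⟨d, hd⟩ := h
    exact ⟨c * d, by rw [hd, smul_smul]⟩
  | measure k m M complete U next ih =>
    intro i
    rw [applyLocal_smul]
    exact ih i (h i)

theorem Deterministic.smul {P : Protocol N} {φ : State N} (h : P.Deterministic φ) (c : ℂ) :
    P.Deterministic (c • φ) := by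
  induction P generalizing φ with
  | done => trivial
  | measure k m M complete U next ih =>
    obtain ⟨⟨φ', hφ'⟩, hn⟩ := h
    refine ⟨⟨φ', fun i => ?_⟩, fun i => ?_⟩
    · obtain ⟨d, hd⟩ := hφ' i
      exact ⟨c * d, by rw [applyLocal_smul, hd, smul_smul]⟩
    · rw [applyLocal_smul]
      exact ih i (hn i)

theorem Reaches.append {P Q : Protocol N} {φ χ ψ : State N} (hP : P.Reaches φ χ)
    (hQ : Q.Reaches χ ψ) : (P.append Q).Reaches φ ψ := by
  induction P generalizing φ with
  | done =>
    obtain ⟨d, rfl⟩ := hP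
    exact hQ.smul d
  | measure k m M complete U next ih => exact fun i => ih i (hP i)

theorem Deterministic.append {P Q : Protocol N} {φ χ : State N} (hP : P.Deterministic φ)
    (hPr : P.Reaches φ χ) (hQ : Q.Deterministic χ) : (P.append Q).Deterministic φ := by
  induction P generalizing φ with
  | done =>
    obtain ⟨d, rfl⟩ := hPr
    exact hQ.smul d
  | measure k m M complete U next ih =>
    exact ⟨hP.1, fun i => ih i (hP.2 i) (hPr i)⟩

end Protocol

/-- If every outcome gave zero, undoing the unitaries and applying `(M i)ᴴ` would give zero as well;
by completeness these vectors sum to `φ`. -/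
theorem exists_applyLocal_roundOp_ne_zero {k : Fin N} {m : ℕ} {M : Fin m → LocalOp}
    (hM : ∑ i, (M i)ᴴ * M i = 1) (U : Fin m → Fin N → Matrix.unitaryGroup TwoQubit ℂ)
    {φ : State N} (hφ : φ ≠ 0) : ∃ i, applyLocal (roundOp k (M i) (U i)) φ ≠ 0 := by
  by_contra! h0
  apply hφ
  have h1 : ∀ i, applyLocal (Function.update 1 k ((M i)ᴴ * M i)) φ = 0 := by
    intro i
    have h2 : (Function.update 1 k ((M i)ᴴ * M i) : Fin N → LocalOp) =
        Function.update (fun j => (U i j : LocalOp)ᴴ) k (M i)ᴴ * roundOp k (M i) (U i) := by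
      funext j
      by_cases hj : j = k
      · subst hj; simp [roundOp]
      · simp only [roundOp, Pi.mul_apply, Function.update_of_ne hj]
        exact (Matrix.mem_unitaryGroup_iff'.mp (U i j).2).symm
    rw [h2, ← applyLocal_applyLocal, h0, applyLocal_zero]
  funext x
  have h3 : applyLocal (Function.update 1 k (∑ i, (M i)ᴴ * M i)) φ x =
      ∑ i, applyLocal (Function.update 1 k ((M i)ᴴ * M i)) φ x := by
    simp only [applyLocal_update_one, Matrix.sum_apply, Finset.sum_mul]
    exact Finset.sum_comm
  rw [hM, show (Function.update 1 k 1 : Fin N → LocalOp) = 1 from Function.update_eq_self k 1,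
    applyLocal_one] at h3
  rw [h3]
  simp [h1]

/-! ### Matrix lemmas -/

section Matrices

open scoped ComplexOrder MatrixOrder

theorem trace_conjTranspose_mul_self_pos (a : GL TwoQubit ℂ) :
    0 < ((a : LocalOp)ᴴ * (a : LocalOp)).trace :=
  (Matrix.PosDef.conjTranspose_mul_self _
    (Matrix.mulVec_injective_of_isUnit a.isUnit)).trace_pos

theorem exists_ofReal_of_pos {c : ℂ} (hc : 0 < c) : ∃ r : ℝ, 0 < r ∧ (r : ℂ) = c := by
  refine ⟨c.re, (Complex.pos_iff.mp hc).1, ?_⟩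
  exact Complex.ext rfl (Complex.pos_iff.mp hc).2

theorem exists_ofReal_eq_of_mul_eq {x c t : ℂ} (hx : 0 < x) (ht : 0 < t) (h : x = c * t) :
    ∃ r : ℝ, 0 < r ∧ (r : ℂ) = c := by
  apply exists_ofReal_of_pos
  obtain ⟨t, h0, rfl⟩ := exists_ofReal_of_pos ht
  obtain ⟨x, hx0, rfl⟩ := exists_ofReal_of_pos hx
  have : c = ((x / t : ℝ) : ℂ) := by
    have : (t : ℂ) ≠ 0 := by exact_mod_cast h0.ne'
    rw [Complex.ofReal_div, h, mul_div_cancel_right₀ _ this]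
  rw [this, Complex.zero_lt_real]
  exact div_pos hx0 h0

theorem smul_conjTranspose_mul_smul (s : ℝ) (b : LocalOp) :
    ((s : ℂ) • b)ᴴ * ((s : ℂ) • b) = ((s ^ 2 : ℝ) : ℂ) • (bᴴ * b) := by
  rw [Matrix.conjTranspose_smul, Matrix.smul_mul, Matrix.mul_smul, smul_smul]
  congr 1
  simp [pow_two]

theorem coe_conjTranspose_inv_mul (a : GL TwoQubit ℂ) :
    ((a⁻¹ : GL TwoQubit ℂ) : LocalOp)ᴴ * (a : LocalOp)ᴴ = 1 := by
  rw [← Matrix.conjTranspose_mul, ← Units.val_mul, mul_inv_cancel]; simp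

theorem conjTranspose_mul_inv_sandwich (a : GL TwoQubit ℂ) :
    ((a⁻¹ : GL TwoQubit ℂ) : LocalOp)ᴴ * ((a : LocalOp)ᴴ * (a : LocalOp)) *
      ((a⁻¹ : GL TwoQubit ℂ) : LocalOp) = 1 := by
  rw [← mul_assoc, coe_conjTranspose_inv_mul, one_mul, ← Units.val_mul, mul_inv_cancel,
    Units.val_one]

/-- Comparing traces shows that `c` is a positive real, and then `b * a⁻¹` divided by `√c` is
unitary. -/
theorem exists_unitary_mul_eq_smul (a b : GL TwoQubit ℂ) {c : ℂ}
    (h : (b : LocalOp)ᴴ * (b : LocalOp) = c • ((a : LocalOp)ᴴ * (a : LocalOp))) :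
    ∃ (U : Matrix.unitaryGroup TwoQubit ℂ) (s : ℂ),
      (U : LocalOp) * (a : LocalOp) = s • (b : LocalOp) := by
  have htr := congrArg Matrix.trace h
  rw [Matrix.trace_smul, smul_eq_mul] at htr
  obtain ⟨r, hr, rfl⟩ := exists_ofReal_eq_of_mul_eq (trace_conjTranspose_mul_self_pos b)
    (trace_conjTranspose_mul_self_pos a) htr
  have hsr : ((√r)⁻¹ ^ 2) * r = 1 := by
    rw [inv_pow, Real.sq_sqrt hr.le, inv_mul_cancel₀ hr.ne']
  refine ⟨⟨((√r)⁻¹ : ℝ) • ((b * a⁻¹ : GL TwoQubit ℂ) : LocalOp), ?_⟩, (((√r)⁻¹ : ℝ) : ℂ), ?_⟩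
  · rw [Matrix.mem_unitaryGroup_iff', Matrix.star_eq_conjTranspose, ← Complex.coe_smul,
      smul_conjTranspose_mul_smul, Units.val_mul, Matrix.conjTranspose_mul]
    have : ((a⁻¹ : GL TwoQubit ℂ) : LocalOp)ᴴ * (b : LocalOp)ᴴ *
        ((b : LocalOp) * ((a⁻¹ : GL TwoQubit ℂ) : LocalOp)) =
        ((a⁻¹ : GL TwoQubit ℂ) : LocalOp)ᴴ * ((b : LocalOp)ᴴ * (b : LocalOp)) *
          ((a⁻¹ : GL TwoQubit ℂ) : LocalOp) := by simp only [mul_assoc]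
    rw [this, h, Matrix.mul_smul, Matrix.smul_mul, conjTranspose_mul_inv_sandwich, smul_smul,
      ← Complex.ofReal_mul, hsr, Complex.ofReal_one, one_smul]
  · change (((√r)⁻¹ : ℝ) • ((b * a⁻¹ : GL TwoQubit ℂ) : LocalOp)) * (a : LocalOp) = _
    rw [Matrix.smul_mul, ← Units.val_mul, inv_mul_cancel_right, Complex.coe_smul]

theorem exists_specialLinear_conjTranspose_mul_self {X : Matrix (Fin 2) (Fin 2) ℂ}
    (hX : X.det ≠ 0) :
    ∃ (A : Matrix.SpecialLinearGroup (Fin 2) ℂ) (r : ℝ), 0 < r ∧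
      Xᴴ * X = (r : ℂ) • ((A : Matrix (Fin 2) (Fin 2) ℂ)ᴴ * (A : Matrix (Fin 2) (Fin 2) ℂ)) := by
  -- Dividing a 2 × 2 matrix by a square root of its determinant makes the determinant one.
  obtain ⟨z, hz⟩ := IsAlgClosed.exists_pow_nat_eq X.det (n := 2) two_pos
  have hz0 : z ≠ 0 := by
    rintro rfl
    exact hX (by rw [← hz]; simp)
  refine ⟨⟨z⁻¹ • X, ?_⟩, Complex.normSq z, Complex.normSq_pos.mpr hz0, ?_⟩
  · rw [Matrix.det_smul, Fintype.card_fin, ← hz, inv_pow, inv_mul_cancel₀ (pow_ne_zero 2 hz0)]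
  · change _ = _ • ((z⁻¹ • X)ᴴ * (z⁻¹ • X))
    rw [Matrix.conjTranspose_smul, Matrix.smul_mul, Matrix.mul_smul, smul_smul, smul_smul]
    have : (Complex.normSq z : ℂ) * star z⁻¹ * z⁻¹ = 1 := by
      rw [Complex.normSq_eq_conj_mul_self, star_inv₀]
      have : star z ≠ 0 := star_ne_zero.mpr hz0
      change star z * z * _ * _ = 1
      field_simp
    rw [this, one_smul]

/-- The Pauli matrices, rescaled to have determinant one. -/
noncomputable def pauli : Fin 4 → Matrix.SpecialLinearGroup (Fin 2) ℂ :=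
  ![1, ⟨!![Complex.I, 0; 0, -Complex.I], by simp [Matrix.det_fin_two]⟩,
    ⟨!![0, 1; -1, 0], by simp [Matrix.det_fin_two]⟩,
    ⟨!![0, Complex.I; Complex.I, 0], by simp [Matrix.det_fin_two]⟩]

theorem pauli_conjTranspose_mul_self (t : Fin 4) : (pauli t).1ᴴ * (pauli t).1 = 1 := by
  fin_cases t <;> ext i j <;> fin_cases i <;> fin_cases j <;>
    simp [pauli, Matrix.mul_apply, Fin.sum_univ_two]

theorem sum_pauli_apply (i j b c : Fin 2) :
    ∑ t, star ((pauli t).1 i b) * (pauli t).1 j c = if i = j ∧ b = c then 2 else 0 := by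
  fin_cases i <;> fin_cases j <;> fin_cases b <;> fin_cases c <;>
    simp [pauli, Fin.sum_univ_four] <;> norm_num

/-- The partial trace over the second qubit. -/
def traceRight (H : LocalOp) : Matrix (Fin 2) (Fin 2) ℂ :=
  Matrix.of fun a' a => ∑ b, H (a', b) (a, b)

/-- The Pauli sum depolarizes the second qubit, by the orthogonality relation `sum_pauli_apply`. -/
theorem sum_pauli_right (H : LocalOp) :
    ∑ t, (kronGL 1 (pauli t) : LocalOp)ᴴ * H * (kronGL 1 (pauli t) : LocalOp) =
      (2 : ℂ) • (traceRight H ⊗ₖ (1 : Matrix (Fin 2) (Fin 2) ℂ)) := by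
  ext ⟨a', b'⟩ ⟨a, b⟩
  have key : ∀ i j : Fin 2, ∑ t, star ((pauli t).1 i b') * H (a', i) (a, j) * (pauli t).1 j b =
      H (a', i) (a, j) * if i = j ∧ b' = b then 2 else 0 := by
    intro i j
    rw [← sum_pauli_apply, Finset.mul_sum]
    exact Finset.sum_congr rfl fun t _ => by ring
  have : ∀ t, ((kronGL 1 (pauli t) : LocalOp)ᴴ * H * (kronGL 1 (pauli t) : LocalOp))
      (a', b') (a, b) =
      ∑ j, ∑ i, star ((pauli t).1 i b') * H (a', i) (a, j) * (pauli t).1 j b := by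
    intro t
    simp only [coe_kronGL, Matrix.mul_apply, Matrix.conjTranspose_apply,
      Matrix.kroneckerMap_apply, Fintype.sum_prod_type, Matrix.SpecialLinearGroup.coe_one,
      Matrix.one_apply]
    fin_cases a <;> fin_cases a' <;> simp [Fin.sum_univ_two] <;> ring
  rw [Matrix.sum_apply, Finset.sum_congr rfl fun t _ => this t, Finset.sum_comm]
  simp_rw [Finset.sum_comm (s := (Finset.univ : Finset (Fin 4)))]
  simp only [key]
  fin_cases b <;> fin_cases b' <;>
    simp [traceRight, Fin.sum_univ_two, Matrix.kroneckerMap_apply] <;> ring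

theorem sum_pauli_left (X : Matrix (Fin 2) (Fin 2) ℂ) :
    ∑ t, (kronGL (pauli t) 1 : LocalOp)ᴴ * (X ⊗ₖ (1 : Matrix (Fin 2) (Fin 2) ℂ)) *
      (kronGL (pauli t) 1 : LocalOp) = (2 * X.trace) • (1 : LocalOp) := by
  have h1 : ∀ t, (kronGL (pauli t) 1 : LocalOp)ᴴ * (X ⊗ₖ (1 : Matrix (Fin 2) (Fin 2) ℂ)) *
      (kronGL (pauli t) 1 : LocalOp) = ((pauli t).1ᴴ * X * (pauli t).1) ⊗ₖ 1 := by
    intro t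
    rw [coe_kronGL, Matrix.conjTranspose_kronecker, ← Matrix.mul_kronecker_mul,
      ← Matrix.mul_kronecker_mul]
    simp
  have h2 : ∀ i j, ∑ t, ((pauli t).1ᴴ * X * (pauli t).1) i j = if i = j then 2 * X.trace else 0 := by
    intro i j
    have key : ∀ a b : Fin 2, ∑ t, star ((pauli t).1 a i) * X a b * (pauli t).1 b j =
        X a b * if a = b ∧ i = j then 2 else 0 := by
      intro a b
      rw [← sum_pauli_apply, Finset.mul_sum]
      exact Finset.sum_congr rfl fun t _ => by ring
    simp only [Matrix.mul_apply, Matrix.conjTranspose_apply, Finset.sum_mul]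
    rw [Finset.sum_comm]
    simp_rw [Finset.sum_comm (s := (Finset.univ : Finset (Fin 4)))]
    simp only [key]
    split_ifs with h <;> simp [Matrix.trace, Fin.sum_univ_two, h]
    ring
  simp only [h1]
  ext ⟨a', b'⟩ ⟨a, b⟩
  simp only [Matrix.sum_apply, Matrix.kroneckerMap_apply, ← Finset.sum_mul, h2,
    Matrix.smul_apply, Matrix.one_apply, smul_eq_mul, Prod.mk.injEq]
  by_cases e1 : a' = a <;> by_cases e2 : b' = b <;> simp [e1, e2]

theorem posDef_traceRight {H : LocalOp} (hH : H.PosDef) : (traceRight H).PosDef := by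
  -- `V b` embeds the first qubit with the second one in basis state `b`; the partial trace is the
  -- sum of the two compressions.
  let V : Fin 2 → Matrix TwoQubit (Fin 2) ℂ := fun b =>
    Matrix.of fun p a => if p = (a, b) then 1 else 0
  have hV : ∀ b, ((V b)ᴴ * H * V b).PosDef := by
    intro b
    refine hH.conjTranspose_mul_mul_same fun v w hvw => ?_
    funext a
    simpa [V, Matrix.mulVec, dotProduct] using congrFun hvw (a, b)
  have : traceRight H = (V 0)ᴴ * H * V 0 + (V 1)ᴴ * H * V 1 := by
    ext a' a
    simp [traceRight, V, Matrix.mul_apply, Matrix.conjTranspose_apply, apply_ite star]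
  rw [this]
  exact (hV 0).add (hV 1)

theorem exists_traceRight_eq (g : GL TwoQubit ℂ) :
    ∃ (A : Matrix.SpecialLinearGroup (Fin 2) ℂ) (r : ℝ), 0 < r ∧
      traceRight ((g : LocalOp)ᴴ * (g : LocalOp)) =
        (r : ℂ) • ((A : Matrix (Fin 2) (Fin 2) ℂ)ᴴ * (A : Matrix (Fin 2) (Fin 2) ℂ)) := by
  have hρ := posDef_traceRight (Matrix.PosDef.conjTranspose_mul_self _
    (Matrix.mulVec_injective_of_isUnit g.isUnit))
  obtain ⟨X, hX⟩ : ∃ X : Matrix (Fin 2) (Fin 2) ℂ,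
      traceRight ((g : LocalOp)ᴴ * (g : LocalOp)) = Xᴴ * X := by
    obtain ⟨X, hX, -, hX'⟩ := CFC.exists_sqrt_of_isSelfAdjoint_of_quasispectrumRestricts
      hρ.isHermitian (QuasispectrumRestricts.nnreal_of_nonneg hρ.posSemidef.nonneg)
    exact ⟨X, hX'.symm.trans (congrArg (· * X) hX.star_eq.symm)⟩
  rw [hX]
  apply exists_specialLinear_conjTranspose_mul_self
  intro h0
  have := hρ.det_pos
  rw [hX, Matrix.det_mul, h0, mul_zero] at this
  exact lt_irrefl _ this

end Matrices

end Protocols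

/-! ### Building a protocol around the cycle -/

section Sufficiency

variable {N : ℕ} [NeZero N]

/-! ### Realizing the single-round condition -/

open scoped ComplexOrder in
-- The Kraus operators are `h k * S i k * (g k)⁻¹` weighted by `√(p i / r)`. Invariance of `H j` up
-- to a factor lets party `j` turn `h j` into a multiple of `h j * S i j` by a unitary, and the
-- symmetry `S i` is then absorbed by the network state.
theorem exists_round {g h : Fin N → GL TwoQubit ℂ} {k : Fin N} (hgh : ∀ j, j ≠ k → g j = h j)
    (hS : SingleRoundCondition h k ((g k : LocalOp)ᴴ * (g k : LocalOp))) :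
    ∃ (m : ℕ) (M : Fin m → LocalOp) (_ : ∑ i, (M i)ᴴ * M i = 1)
      (U : Fin m → Fin N → Matrix.unitaryGroup TwoQubit ℂ),
      ∀ i, IsMultiple
        (applyLocal (roundOp k (M i) (U i)) (applyLocal (toOps g) (networkState N)))
        (applyLocal (toOps h) (networkState N)) := by
  obtain ⟨m, S, p, hsym, hp0, hp1, hinv, r, hr⟩ := hS
  have hSH : ∀ i j, (S i j : LocalOp)ᴴ * ((h j : LocalOp)ᴴ * (h j : LocalOp)) * (S i j : LocalOp) =
      ((h j * S i j : GL TwoQubit ℂ) : LocalOp)ᴴ * ((h j * S i j : GL TwoQubit ℂ) : LocalOp) := by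
    intro i j
    rw [Units.val_mul, Matrix.conjTranspose_mul]
    simp only [mul_assoc]
  simp only [hSH] at hr hinv
  have hr0 : 0 < r := by
    have htr := congrArg Matrix.trace hr
    rw [Matrix.trace_sum, Matrix.trace_smul, smul_eq_mul] at htr
    have hpos : (0 : ℂ) < ∑ i, ((p i : ℂ) • (((h k * S i k : GL TwoQubit ℂ) : LocalOp)ᴴ *
        ((h k * S i k : GL TwoQubit ℂ) : LocalOp))).trace := by
      refine Finset.sum_pos' (fun i _ => ?_) ?_
      · rw [Matrix.trace_smul, smul_eq_mul]
        exact mul_nonneg (by exact_mod_cast hp0 i) (trace_conjTranspose_mul_self_pos _).le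
      · obtain ⟨i, hi, hi0⟩ := Finset.exists_ne_zero_of_sum_ne_zero (hp1.trans_ne one_ne_zero)
        refine ⟨i, hi, ?_⟩
        rw [Matrix.trace_smul, smul_eq_mul]
        exact mul_pos (by exact_mod_cast (hp0 i).lt_of_ne' hi0) (trace_conjTranspose_mul_self_pos _)
    obtain ⟨r', hr', he⟩ := exists_ofReal_eq_of_mul_eq hpos
      (trace_conjTranspose_mul_self_pos (g k)) htr
    rwa [← Complex.ofReal_injective he]
  have hU : ∀ i j, ∃ (U : Matrix.unitaryGroup TwoQubit ℂ) (s : ℂ),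
      j ≠ k → (U : LocalOp) * (h j : LocalOp) = s • ((h j * S i j : GL TwoQubit ℂ) : LocalOp) := by
    intro i j
    by_cases hj : j = k
    -- Placeholders at `j = k`: `roundOp` ignores this unitary, and the scalar is overwritten by the
    -- Kraus weight.
    · exact ⟨1, 0, fun h => absurd hj h⟩
    · obtain ⟨c, hc⟩ := hinv i j hj
      obtain ⟨U, s, hU⟩ := exists_unitary_mul_eq_smul _ _ hc
      exact ⟨U, s, fun _ => hU⟩
  choose U s hUs using hU
  have hq : ∀ i, 0 ≤ p i / r := fun i => div_nonneg (hp0 i) hr0.le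
  refine ⟨m, fun i => ((√(p i / r) : ℝ) : ℂ) • ((h k * S i k * (g k)⁻¹ : GL TwoQubit ℂ) : LocalOp),
    ?_, U, fun i => ⟨∏ j, Function.update (s i) k ((√(p i / r) : ℝ) : ℂ) j, ?_⟩⟩
  · have h1 : ∀ i, ((√(p i / r) : ℂ) • ((h k * S i k * (g k)⁻¹ : GL TwoQubit ℂ) : LocalOp))ᴴ *
        ((√(p i / r) : ℂ) • ((h k * S i k * (g k)⁻¹ : GL TwoQubit ℂ) : LocalOp)) =
        ((r : ℂ)⁻¹) • (((g k)⁻¹ : GL TwoQubit ℂ).valᴴ *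
          ((p i : ℂ) • (((h k * S i k : GL TwoQubit ℂ) : LocalOp)ᴴ *
            ((h k * S i k : GL TwoQubit ℂ) : LocalOp))) * ((g k)⁻¹ : GL TwoQubit ℂ).val) := by
      intro i
      rw [smul_conjTranspose_mul_smul, Real.sq_sqrt (hq i), Units.val_mul (h k * S i k),
        Matrix.conjTranspose_mul, Matrix.mul_smul, Matrix.smul_mul, smul_smul]
      congr 1
      · push_cast; ring
      · simp only [mul_assoc]
    simp only [h1]
    rw [← Finset.smul_sum, ← Finset.sum_mul, ← Finset.mul_sum, hr, Matrix.mul_smul,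
      Matrix.smul_mul, conjTranspose_mul_inv_sandwich, smul_smul, inv_mul_cancel₀, one_smul]
    exact_mod_cast hr0.ne'
  · rw [applyLocal_applyLocal, ← (hsym i).applyLocal_mul h, ← applyLocal_smul_ops]
    congr 1
    funext j
    by_cases hj : j = k
    · subst hj
      simp only [roundOp, toOps, Pi.mul_apply, Function.update_self, Matrix.smul_mul]
      rw [← Units.val_mul, inv_mul_cancel_right]
    · simp only [roundOp, toOps, Pi.mul_apply, Function.update_of_ne hj]
      rw [hgh j hj]
      exact hUs i j hj

/-- The state with local operators `g` can be reached from the network state by a deterministic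
protocol in which the parties in `T` measure at most once and the other parties do not measure. -/
def Reachable (T : Finset (Fin N)) (g : Fin N → GL TwoQubit ℂ) : Prop :=
  ∃ P : Protocol N, (∀ j, P.measurementCount j ≤ if j ∈ T then 1 else 0) ∧
    P.Deterministic (networkState N) ∧
    P.Reaches (networkState N) (applyLocal (toOps g) (networkState N))

theorem reachable_empty_one : Reachable ∅ (1 : Fin N → GL TwoQubit ℂ) := by
  refine ⟨.done, fun j => by simp [Protocol.measurementCount], trivial, 1, ?_⟩
  rw [one_smul, toOps_one, applyLocal_one]

/-- Used with gauge symmetries to move a one-qubit operator across an edge to the neighbouring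
party. -/
theorem Reachable.of_mul {T : Finset (Fin N)} {g S : Fin N → GL TwoQubit ℂ}
    (h : Reachable T (g * S)) (hS : IsLocalSymmetry S) : Reachable T g := by
  obtain ⟨P, hP⟩ := h
  rw [hS.applyLocal_mul] at hP
  exact ⟨P, hP⟩

theorem Reachable.insert {T : Finset (Fin N)} {g h : Fin N → GL TwoQubit ℂ} {k : Fin N}
    (hg : Reachable T g) (hk : k ∉ T) (hgh : ∀ j, j ≠ k → g j = h j)
    (hS : SingleRoundCondition h k ((g k : LocalOp)ᴴ * (g k : LocalOp))) :
    Reachable (insert k T) h := by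
  obtain ⟨P, hPc, hPd, hPr⟩ := hg
  obtain ⟨m, M, hM, U, hMU⟩ := exists_round hgh hS
  refine ⟨P.append (.measure k m M hM U fun _ => .done), fun j => ?_, hPd.append hPr ?_,
    hPr.append ?_⟩
  · refine (Protocol.measurementCount_append_le _ _ _).trans ?_
    have h1 := hPc j
    have h2 : (Finset.univ.sup fun _ : Fin m => (Protocol.done : Protocol N).measurementCount j) = 0 := by
      simp [Protocol.measurementCount]
    rw [Protocol.measurementCount, h2]
    by_cases hj : k = j
    · subst hj; simp [hk] at h1 ⊢; omega
    · simp only [hj, if_false, Finset.mem_insert, Ne.symm hj, false_or]; omega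
  · exact ⟨⟨_, hMU⟩, fun _ => trivial⟩
  · exact hMU

theorem singleRoundCondition_of_sum_eq {ι : Type*} [Fintype ι] [Nonempty ι]
    {h : Fin N → GL TwoQubit ℂ} {k : Fin N} {G : LocalOp} (S : ι → Fin N → GL TwoQubit ℂ)
    (hsym : ∀ i, IsLocalSymmetry (S i))
    (hinv : ∀ i, ∀ j, j ≠ k →
      (S i j : LocalOp)ᴴ * ((h j : LocalOp)ᴴ * (h j : LocalOp)) * (S i j : LocalOp) =
        (h j : LocalOp)ᴴ * (h j : LocalOp))
    (r : ℝ) (hr : ∑ i, (S i k : LocalOp)ᴴ * ((h k : LocalOp)ᴴ * (h k : LocalOp)) *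
      (S i k : LocalOp) = (r : ℂ) • G) :
    SingleRoundCondition h k G := by
  have hc : (Fintype.card ι : ℝ) ≠ 0 := by exact_mod_cast Fintype.card_ne_zero
  refine ⟨Fintype.card ι, fun i => S ((Fintype.equivFin ι).symm i),
    fun _ => (Fintype.card ι : ℝ)⁻¹, fun i => hsym _, fun i => by positivity, ?_,
    fun i j hj => ⟨1, by rw [one_smul]; exact hinv _ j hj⟩, (Fintype.card ι : ℝ)⁻¹ * r, ?_⟩
  · simp [hc]
  · rw [← Finset.smul_sum, Equiv.sum_comp (Fintype.equivFin ι).symm fun i =>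
      (S i k : LocalOp)ᴴ * ((h k : LocalOp)ᴴ * (h k : LocalOp)) * (S i k : LocalOp), hr, smul_smul]
    push_cast
    rfl

theorem kronGL_conjTranspose_mul_self {A B : Matrix.SpecialLinearGroup (Fin 2) ℂ}
    (hA : A.1ᴴ * A.1 = 1) (hB : B.1ᴴ * B.1 = 1) :
    (kronGL A B : LocalOp)ᴴ * (kronGL A B : LocalOp) = 1 := by
  rw [coe_kronGL, Matrix.conjTranspose_kronecker, ← Matrix.mul_kronecker_mul, hA, hB,
    Matrix.one_kronecker_one]

theorem kronGL_conjTranspose_mul_self_eq (A B : Matrix.SpecialLinearGroup (Fin 2) ℂ) :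
    (kronGL A B : LocalOp)ᴴ * (kronGL A B : LocalOp) = (A.1ᴴ * A.1) ⊗ₖ (B.1ᴴ * B.1) := by
  rw [coe_kronGL, Matrix.conjTranspose_kronecker, ← Matrix.mul_kronecker_mul]

/-- The Pauli matrices `pauli s` and `pauli t` on the edges of the cycle after and before the
party `k`. -/
noncomputable def pauliPair (k : Fin N) (s t : Fin 4) :
    Fin N → Matrix.SpecialLinearGroup (Fin 2) ℂ :=
  Function.update (Function.update 1 k (pauli t)) (k + 1) (pauli s)

theorem pauliPair_conjTranspose_mul_self (k : Fin N) (s t : Fin 4) (l : Fin N) :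
    (pauliPair k s t l).1ᴴ * (pauliPair k s t l).1 = 1 := by
  rw [pauliPair]
  by_cases e' : l = k + 1
  · subst e'; simp [pauli_conjTranspose_mul_self]
  · by_cases e : l = k
    · subst e; simp [e', pauli_conjTranspose_mul_self]
    · simp [e, e']

/-- The first party to measure can implement any invertible operator. -/
theorem singleRoundCondition_update_one (hN : 2 ≤ N) (k : Fin N) (b : GL TwoQubit ℂ) :
    SingleRoundCondition (Function.update 1 k b) k (((1 : GL TwoQubit ℂ) : LocalOp)ᴴ *
      ((1 : GL TwoQubit ℂ) : LocalOp)) := by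
  have hk := add_one_ne_self hN k
  obtain ⟨A, r, hr0, hr⟩ := exists_traceRight_eq b
  refine singleRoundCondition_of_sum_eq
    (fun st : Fin 4 × Fin 4 => gauge (pauliPair k st.1 st.2)) (fun i => isLocalSymmetry_gauge _) ?_
    -- Each of the two Pauli sums contributes a factor 2, and the left one also the trace of the
    -- reduced operator `r • (Aᴴ * A)`.
    (4 * (r * (((A.1ᴴ * A.1).trace).re))) ?_
  · rintro ⟨s, t⟩ j hj
    rw [Function.update_of_ne hj]
    simp only [Pi.one_apply, Units.val_one, Matrix.conjTranspose_one, mul_one]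
    exact kronGL_conjTranspose_mul_self (pauliPair_conjTranspose_mul_self k s t j)
      (pauliPair_conjTranspose_mul_self k s t (j + 1))
  · have h2 : ∀ st : Fin 4 × Fin 4, (gauge (pauliPair k st.1 st.2) k : LocalOp)ᴴ *
        ((b : LocalOp)ᴴ * (b : LocalOp)) * (gauge (pauliPair k st.1 st.2) k : LocalOp) =
        (kronGL (pauli st.2) 1 : LocalOp)ᴴ * ((kronGL 1 (pauli st.1) : LocalOp)ᴴ *
          ((b : LocalOp)ᴴ * (b : LocalOp)) * (kronGL 1 (pauli st.1) : LocalOp)) *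
          (kronGL (pauli st.2) 1 : LocalOp) := by
      intro st
      have h1 : gauge (pauliPair k st.1 st.2) k =
          kronGL 1 (pauli st.1) * kronGL (pauli st.2) 1 := by
        simp [gauge, pauliPair, hk.symm, kronGL_mul]
      rw [h1, Units.val_mul, Matrix.conjTranspose_mul]
      simp only [mul_assoc]
    simp only [Function.update_self, h2]
    rw [Fintype.sum_prod_type, Finset.sum_comm]
    simp only [← Finset.sum_mul, ← Finset.mul_sum, sum_pauli_right]
    simp only [Matrix.mul_smul, Matrix.smul_mul]
    rw [← Finset.smul_sum, sum_pauli_left, hr, Matrix.trace_smul]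
    have him : (((A.1ᴴ * A.1).trace).re : ℂ) = (A.1ᴴ * A.1).trace := by
      rw [← Complex.conj_eq_iff_re, ← Complex.star_def, ← Matrix.trace_conjTranspose,
        Matrix.conjTranspose_mul, Matrix.conjTranspose_conjTranspose]
    push_cast
    rw [him, smul_smul, Matrix.conjTranspose_one, mul_one, smul_eq_mul]
    congr 1
    ring

/-- A party whose next neighbour has not measured yet can implement any invertible operator,
starting from an operator on its first qubit. -/
theorem exists_singleRoundCondition (hN : 2 ≤ N) {h : Fin N → GL TwoQubit ℂ} {k : Fin N}
    (hk1 : h (k + 1) = 1) :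
    ∃ A : Matrix.SpecialLinearGroup (Fin 2) ℂ,
      SingleRoundCondition h k ((kronGL A 1 : LocalOp)ᴴ * (kronGL A 1 : LocalOp)) := by
  have hk := add_one_ne_self hN k
  obtain ⟨A, r, hr0, hr⟩ := exists_traceRight_eq (h k)
  refine ⟨A, singleRoundCondition_of_sum_eq
    (fun t : Fin 4 => gauge (Function.update 1 (k + 1) (pauli t)))
    (fun i => isLocalSymmetry_gauge _) ?_ (2 * r) ?_⟩
  · intro t j hj
    rw [gauge_update_one_eq hk]
    by_cases e : j = k + 1
    · subst e
      simp only [Function.update_self, hk1, Units.val_one, Matrix.conjTranspose_one, mul_one]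
      exact kronGL_conjTranspose_mul_self (pauli_conjTranspose_mul_self t) (by simp)
    · simp [e, hj]
  · simp only [gauge_update_one_eq hk, Function.update_of_ne hk.symm, Function.update_self]
    rw [sum_pauli_right, hr, kronGL_conjTranspose_mul_self_eq, Matrix.smul_kronecker, smul_smul]
    simp

/-- The parties `k + 1`, …, `k + t` of the cycle. -/
def arc (k : Fin N) : ℕ → Finset (Fin N)
  | 0 => ∅
  | t + 1 => insert ((· + 1)^[t + 1] k) (arc k t)

open scoped Fin.CommRing in
theorem iterate_add_one (k : Fin N) (t : ℕ) : (· + 1)^[t] k = k + (t : Fin N) := by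
  induction t with
  | zero => simp
  | succ t ih => rw [Function.iterate_succ_apply', ih, Nat.cast_succ, add_assoc]

open scoped Fin.CommRing in
theorem iterate_add_one_ne (k : Fin N) {s t : ℕ} (hst : s < t) (ht : t < s + N) :
    (· + 1)^[s] k ≠ (· + 1)^[t] k := by
  intro h
  rw [iterate_add_one, iterate_add_one] at h
  have h1 := add_left_cancel h
  obtain ⟨d, rfl⟩ := Nat.exists_eq_add_of_lt hst
  rw [add_assoc, Nat.cast_add] at h1
  exact natCast_fin_ne_zero (N := N) (t := d + 1) (by omega) (by omega) (left_eq_add.mp h1)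

theorem mem_arc {k j : Fin N} {t : ℕ} :
    j ∈ arc k t ↔ ∃ s, 1 ≤ s ∧ s ≤ t ∧ j = (· + 1)^[s] k := by
  induction t with
  | zero =>
    simp only [arc, Finset.notMem_empty, false_iff]
    rintro ⟨s, h1, h2, -⟩
    omega
  | succ t ih =>
    rw [arc, Finset.mem_insert, ih]
    constructor
    · rintro (rfl | ⟨s, h1, h2, rfl⟩)
      · exact ⟨t + 1, by omega, le_rfl, rfl⟩
      · exact ⟨s, h1, by omega, rfl⟩
    · rintro ⟨s, h1, h2, rfl⟩
      rcases h2.lt_or_eq with h | rfl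
      · exact Or.inr ⟨s, h1, by omega, rfl⟩
      · exact Or.inl rfl

theorem iterate_notMem_arc {k : Fin N} {s t : ℕ} (hts : t < s) (hs : s ≤ N) :
    (· + 1)^[s] k ∉ arc k t := by
  rw [mem_arc]
  rintro ⟨u, h1, h2, h⟩
  exact iterate_add_one_ne k (show u < s by omega) (by omega) h.symm

/-- The induction must allow arbitrary operators on the arc: removing the last party `l` leaves `A ⊗
1` at `l`, which is pushed onto `l - 1` and changes the operator there. -/
theorem reachable_arc (hN : 3 ≤ N) (k : Fin N) (t : ℕ) (ht : t + 1 ≤ N)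
    (g : Fin N → GL TwoQubit ℂ) (hg : ∀ j, j ∉ arc k t → g j = 1) : Reachable (arc k t) g := by
  induction t generalizing g with
  | zero =>
    have : g = 1 := funext fun j => hg j (by simp [arc])
    rw [this]
    exact reachable_empty_one
  | succ t ih =>
    set l := (· + 1)^[t + 1] k with hl
    have hlt : l ∉ arc k t := iterate_notMem_arc (by omega) (by omega)
    have hl1 : l + 1 ≠ l := add_one_ne_self (by omega) l
    -- The first party has no predecessor in the arc to take over `A`, so it depolarizes both of its
    -- qubits instead.
    rcases Nat.eq_zero_or_pos t with rfl | ht0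
    · have hgl : g = Function.update (1 : Fin N → GL TwoQubit ℂ) l (g l) := by
        funext j
        by_cases hj : j = l
        · subst hj; simp
        · rw [Function.update_of_ne hj]
          exact hg j (by simpa [arc, hl] using hj)
      refine Reachable.insert (g := 1) reachable_empty_one hlt (fun j hj => ?_) ?_
      · rw [hgl, Function.update_of_ne hj]
      · rw [hgl]
        exact singleRoundCondition_update_one (by omega) l (g l)
    · have hgl1 : g (l + 1) = 1 := by
        apply hg
        have : l + 1 = (· + 1)^[t + 2] k := (Function.iterate_succ_apply' (· + 1) _ _).symm
        rw [this]
        -- In the extreme case `t + 2 = N` the next neighbour is `k` itself, which has not measured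
        -- yet.
        exact iterate_notMem_arc (by omega) (by omega)
      obtain ⟨A, hA⟩ := exists_singleRoundCondition (by omega) hgl1
      refine Reachable.insert (g := Function.update g l (kronGL A 1)) ?_ hlt
        (fun j hj => Function.update_of_ne hj _ _) (by rwa [Function.update_self])
      -- `A⁻¹` on the edge before `l` cancels `A ⊗ 1` at `l` and multiplies the operator of the
      -- previous party by `1 ⊗ A⁻¹`.
      refine Reachable.of_mul (S := gauge (Function.update 1 l A⁻¹)) (ih (by omega) _ ?_)
        (isLocalSymmetry_gauge _)
      intro j hj
      by_cases e : j = l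
      · subst e
        simp [gauge, hl1, kronGL_mul, kronGL_one]
      · have e' : j + 1 ≠ l := by
          intro h
          apply hj
          rw [hl, Function.iterate_succ_apply'] at h
          rw [mem_arc]
          exact ⟨t, ht0, le_rfl, add_right_cancel h⟩
        have : j ∉ arc k (t + 1) := by
          rw [arc, Finset.mem_insert, not_or]
          exact ⟨e, hj⟩
        simp [gauge, e, e', kronGL_one, hg j this]

theorem reachable_of_singleRoundCondition (hN : 3 ≤ N) {h : Fin N → GL TwoQubit ℂ} {k : Fin N}
    {A B : Matrix.SpecialLinearGroup (Fin 2) ℂ}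
    (hS : SingleRoundCondition h k ((A.1ᴴ * A.1) ⊗ₖ (B.1ᴴ * B.1))) :
    Reachable (insert k (arc k (N - 1))) h := by
  have hk := add_one_ne_self (show 2 ≤ N by omega) k
  have hkN : k ∉ arc k (N - 1) := by
    rw [mem_arc]
    rintro ⟨s, h1, h2, h3⟩
    exact iterate_add_one_ne k (show 0 < s by omega) (by omega) h3
  refine Reachable.insert (g := Function.update h k (kronGL A B)) ?_ hkN
    (fun j hj => Function.update_of_ne hj _ _)
    (by rwa [Function.update_self, kronGL_conjTranspose_mul_self_eq])
  refine Reachable.of_mul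
    (S := gauge (Function.update (Function.update 1 k A⁻¹) (k + 1) B⁻¹))
    (reachable_arc hN k (N - 1) (by omega) _ ?_) (isLocalSymmetry_gauge _)
  intro j hj
  -- The arc of length `N - 1` misses only `k`, where the two gauge factors cancel `A ⊗ B`.
  have hjk : j = k := by
    by_contra hjk
    apply hj
    rw [mem_arc]
    refine ⟨(j - k).val, ?_, ?_, ?_⟩
    · rw [Nat.one_le_iff_ne_zero, Ne, Fin.val_eq_zero_iff, sub_eq_zero]
      exact hjk
    · have := (j - k).isLt
      omega
    · rw [iterate_add_one, Fin.cast_val_eq_self, add_sub_cancel]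
  subst hjk
  simp [gauge, hk.symm, kronGL_mul, kronGL_one]

end Sufficiency

/-! ### Extracting the single-round condition from a protocol -/

section Necessity

variable {N : ℕ} [NeZero N]

/-! ### The last round of a protocol -/

theorem exists_specialLinear_of_isLocalSymmetry (hN : 3 ≤ N) {S : Fin N → GL TwoQubit ℂ}
    (hS : IsLocalSymmetry S) (k : Fin N) :
    ∃ (A B : Matrix.SpecialLinearGroup (Fin 2) ℂ) (r : ℝ),
      (S k : LocalOp)ᴴ * (S k : LocalOp) = (r : ℂ) • ((A.1ᴴ * A.1) ⊗ₖ (B.1ᴴ * B.1)) := by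
  obtain ⟨P, Q, hPQ⟩ := exists_kronecker_of_isLocalSymmetry hN hS k
  have hdet : (P ⊗ₖ Q).det ≠ 0 := by
    rw [← hPQ, ← isUnit_iff_ne_zero, ← Matrix.isUnit_iff_isUnit_det]
    exact (S k).isUnit
  rw [Matrix.det_kronecker] at hdet
  have hP : P.det ≠ 0 := fun h => hdet (by simp [h])
  have hQ : Q.det ≠ 0 := fun h => hdet (by simp [h])
  obtain ⟨A, r, -, hA⟩ := exists_specialLinear_conjTranspose_mul_self hP
  obtain ⟨B, s, -, hB⟩ := exists_specialLinear_conjTranspose_mul_self hQ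
  refine ⟨A, B, r * s, ?_⟩
  rw [hPQ, Matrix.conjTranspose_kronecker, ← Matrix.mul_kronecker_mul, hA, hB,
    Matrix.smul_kronecker, Matrix.kronecker_smul, smul_smul]
  push_cast
  rfl

/-- `h⁻¹ * g` fixes the network state up to the factor `c`, and dividing by `c` at party `k` makes
it a symmetry. -/
theorem exists_isLocalSymmetry_of_eq_smul (k : Fin N) {g h : Fin N → GL TwoQubit ℂ} {c : ℂ}
    (hc : c ≠ 0)
    (hgh : applyLocal (toOps g) (networkState N) = c • applyLocal (toOps h) (networkState N)) :
    ∃ S : Fin N → GL TwoQubit ℂ, IsLocalSymmetry S ∧ (∀ j, j ≠ k → g j = h j * S j) ∧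
      (g k : LocalOp) = c • ((h k * S k : GL TwoQubit ℂ) : LocalOp) := by
  let u : GL TwoQubit ℂ := Units.map (algebraMap ℂ LocalOp).toMonoidHom (Units.mk0 c hc)⁻¹
  have hu : (u : LocalOp) = c⁻¹ • (1 : LocalOp) := by
    change algebraMap ℂ LocalOp c⁻¹ = _
    rw [Algebra.algebraMap_eq_smul_one]
  refine ⟨h⁻¹ * g * Function.update (1 : Fin N → GL TwoQubit ℂ) k u, ?_, fun j hj => by simp [hj], ?_⟩
  · have h1 : toOps (h⁻¹ * g * Function.update (1 : Fin N → GL TwoQubit ℂ) k u) =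
        fun j => (Function.update (1 : Fin N → ℂ) k c⁻¹) j • toOps (h⁻¹ * g) j := by
      funext j
      by_cases hj : j = k
      · subst hj; simp [toOps, hu]
      · simp [toOps, hj]
    change applyLocal (toOps _) _ = _
    rw [h1, applyLocal_smul_ops, applyLocal_toOps_mul, hgh, applyLocal_smul,
      ← applyLocal_toOps_mul, inv_mul_cancel, toOps_one, applyLocal_one, smul_smul,
      Finset.prod_update_of_mem (Finset.mem_univ k)]
    simp [hc]
  · simp [hu, smul_smul, hc]

theorem singleRoundCondition_of_last_round (hN : 3 ≤ N) {h g : Fin N → GL TwoQubit ℂ} {k : Fin N}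
    (hgk : (g k : LocalOp)ᴴ * (g k : LocalOp) = 1) {m : ℕ} {M : Fin m → LocalOp}
    (hM : ∑ i, (M i)ᴴ * M i = 1) {U : Fin m → Fin N → Matrix.unitaryGroup TwoQubit ℂ}
    (hMU : ∀ i, IsMultiple (applyLocal (roundOp k (M i) (U i))
      (applyLocal (toOps g) (networkState N))) (applyLocal (toOps h) (networkState N)))
    {i₀ : Fin m} (hi₀ : applyLocal (roundOp k (M i₀) (U i₀))
      (applyLocal (toOps g) (networkState N)) ≠ 0) :
    ∃ A B : Matrix.SpecialLinearGroup (Fin 2) ℂ,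
      SingleRoundCondition h k ((A.1ᴴ * A.1) ⊗ₖ (B.1ᴴ * B.1)) := by
  have hk := add_one_ne_self (show 2 ≤ N by omega) k
  choose c hc using hMU
  let u : Fin m → Fin N → GL TwoQubit ℂ := fun i j => Unitary.toUnits (U i j)
  have hu : ∀ i j, (u i j : LocalOp) = U i j := fun i j => rfl
  have key : ∀ i, ∃ S : Fin N → GL TwoQubit ℂ, IsLocalSymmetry S ∧
      (c i ≠ 0 → ∀ j, j ≠ k → u i j * g j = h j * S j) ∧
      M i * (g k : LocalOp) = c i • ((h k * S k : GL TwoQubit ℂ) : LocalOp) := by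
    intro i
    have hci := hc i
    rw [applyLocal_applyLocal] at hci
    -- For an outcome of probability zero, faithfulness gives `M i * g k = 0`, so the trivial
    -- symmetry serves with weight zero.
    by_cases h0 : c i = 0
    · refine ⟨1, isLocalSymmetry_one, fun h => absurd h0 h, ?_⟩
      rw [h0, zero_smul] at hci ⊢
      apply eq_zero_of_applyLocal_update_eq_zero hk
      apply applyLocal_toOps_injective (Function.update (u i * g) k 1)
      rw [applyLocal_zero, applyLocal_applyLocal, ← hci]
      congr 1
      funext j
      by_cases hj : j = k
      · subst hj; simp [toOps, roundOp]
      · simp [toOps, roundOp, hj, hu]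
    · have hunit : IsUnit (M i * (g k : LocalOp)) := by
        have := isUnit_of_applyLocal_eq_smul hk h0 hci
        simpa [roundOp, toOps] using this
      obtain ⟨v, hv⟩ := hunit
      have h1 : roundOp k (M i) (U i) * toOps g = toOps (Function.update (u i * g) k v) := by
        funext j
        by_cases hj : j = k
        · subst hj; simp [toOps, roundOp, hv]
        · simp [toOps, roundOp, hj, hu]
      rw [h1] at hci
      obtain ⟨S, hS, hS1, hS2⟩ := exists_isLocalSymmetry_of_eq_smul k h0 hci
      refine ⟨S, hS, fun _ j hj => ?_, ?_⟩
      · have := hS1 j hj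
        rwa [Function.update_of_ne hj] at this
      · rwa [Function.update_self, hv] at hS2
  choose S hS hS1 hS2 using key
  have hc0 : c i₀ ≠ 0 := fun h0 => hi₀ (by rw [hc, h0, zero_smul])
  set q : ℝ := ∑ i, Complex.normSq (c i) with hq
  have hq0 : 0 < q := Finset.sum_pos' (fun i _ => Complex.normSq_nonneg _)
    ⟨i₀, Finset.mem_univ _, Complex.normSq_pos.mpr hc0⟩
  obtain ⟨A, B, r, hr⟩ := exists_specialLinear_of_isLocalSymmetry hN (hS i₀).inv k
  have hMi : ∀ i, ((Complex.normSq (c i) : ℝ) : ℂ) •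
      (((h k * S i k : GL TwoQubit ℂ) : LocalOp)ᴴ * ((h k * S i k : GL TwoQubit ℂ) : LocalOp)) =
      (g k : LocalOp)ᴴ * ((M i)ᴴ * M i) * (g k : LocalOp) := by
    intro i
    have : (g k : LocalOp)ᴴ * ((M i)ᴴ * M i) * (g k : LocalOp) =
        (M i * (g k : LocalOp))ᴴ * (M i * (g k : LocalOp)) := by
      rw [Matrix.conjTranspose_mul]; simp only [mul_assoc]
    rw [this, hS2, Matrix.conjTranspose_smul, Matrix.smul_mul, Matrix.mul_smul, smul_smul,
      Complex.normSq_eq_conj_mul_self]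
    rfl
  -- Dividing by the reference symmetry `S i₀` is what makes the `H j` invariant, since `h j`
  -- conjugates `S i j * (S i₀ j)⁻¹` to the unitary `u i j * (u i₀ j)⁻¹`; the right-hand side
  -- becomes the Gram matrix of `(S i₀ k)⁻¹`.
  refine ⟨A, B, m, fun i => if c i = 0 then 1 else S i * (S i₀)⁻¹,
    fun i => Complex.normSq (c i) / q, fun i => ?_,
    fun i => div_nonneg (Complex.normSq_nonneg _) hq0.le, ?_, fun i j hj => ⟨1, ?_⟩, q⁻¹ * r, ?_⟩
  · beta_reduce
    split_ifs
    exacts [isLocalSymmetry_one, (hS i).mul (hS i₀).inv]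
  · rw [← Finset.sum_div, div_self hq0.ne']
  · rw [one_smul]
    by_cases h0 : c i = 0
    · simp [h0]
    · simp only [h0, if_false]
      have h1 : h j * (S i * (S i₀)⁻¹) j = u i j * (u i₀ j)⁻¹ * h j := by
        have e1 := hS1 i h0 j hj
        have e2 := hS1 i₀ hc0 j hj
        rw [Pi.mul_apply, Pi.inv_apply, ← mul_assoc, ← e1, mul_inv_eq_iff_eq_mul]
        rw [mul_assoc, ← e2, mul_assoc, inv_mul_cancel_left]
      have h2 : ((u i j * (u i₀ j)⁻¹ : GL TwoQubit ℂ) : LocalOp)ᴴ *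
          ((u i j * (u i₀ j)⁻¹ : GL TwoQubit ℂ) : LocalOp) = 1 :=
        Matrix.mem_unitaryGroup_iff'.mp (U i j * (U i₀ j)⁻¹).2
      have h3 := congrArg Units.val h1
      rw [Units.val_mul, Units.val_mul] at h3
      calc _ = ((h j : LocalOp) * ((S i * (S i₀)⁻¹) j : LocalOp))ᴴ *
            ((h j : LocalOp) * ((S i * (S i₀)⁻¹) j : LocalOp)) := by
            rw [Matrix.conjTranspose_mul]; simp only [mul_assoc]
        _ = (h j : LocalOp)ᴴ * (((u i j * (u i₀ j)⁻¹ : GL TwoQubit ℂ) : LocalOp)ᴴ *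
            ((u i j * (u i₀ j)⁻¹ : GL TwoQubit ℂ) : LocalOp)) * (h j : LocalOp) := by
            rw [h3, Matrix.conjTranspose_mul]; simp only [mul_assoc]
        _ = _ := by rw [h2, mul_one]
  · have h1 : ∀ i, ((Complex.normSq (c i) / q : ℝ) : ℂ) •
        (((if c i = 0 then 1 else S i * (S i₀)⁻¹ : Fin N → GL TwoQubit ℂ) k : LocalOp)ᴴ *
          ((h k : LocalOp)ᴴ * (h k : LocalOp)) *
          ((if c i = 0 then 1 else S i * (S i₀)⁻¹ : Fin N → GL TwoQubit ℂ) k : LocalOp)) =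
        ((q⁻¹ : ℝ) : ℂ) • ((((S i₀)⁻¹ k : GL TwoQubit ℂ) : LocalOp)ᴴ *
          ((g k : LocalOp)ᴴ * ((M i)ᴴ * M i) * (g k : LocalOp)) *
          (((S i₀)⁻¹ k : GL TwoQubit ℂ) : LocalOp)) := by
      intro i
      rw [← hMi]
      by_cases h0 : c i = 0
      · simp [h0]
      · rw [if_neg h0, Matrix.mul_smul, Matrix.smul_mul, smul_smul]
        congr 1
        · push_cast; ring
        · simp only [Pi.mul_apply, Units.val_mul, Matrix.conjTranspose_mul, mul_assoc]
    simp only [h1]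
    rw [← Finset.smul_sum, ← Finset.sum_mul, ← Finset.mul_sum, ← Finset.sum_mul, ← Finset.mul_sum,
      hM, mul_one, hgk, mul_one]
    change _ • ((((S i₀)⁻¹ k : GL TwoQubit ℂ) : LocalOp)ᴴ *
      (((S i₀)⁻¹ k : GL TwoQubit ℂ) : LocalOp)) = _
    rw [hr, smul_smul, ← Complex.ofReal_mul]

theorem applyLocal_toOps_networkState_ne_zero (hN : 3 ≤ N) (h : Fin N → GL TwoQubit ℂ) :
    applyLocal (toOps h) (networkState N) ≠ 0 := by
  intro h0
  rw [← applyLocal_zero (toOps h)] at h0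
  have h1 := applyLocal_toOps_injective h h0
  have h2 := eq_zero_of_applyLocal_update_eq_zero (add_one_ne_self (show 2 ≤ N by omega) 0)
    (E := 1) (by rw [h1, applyLocal_zero])
  exact one_ne_zero h2

theorem isUnit_of_isMultiple (hN : 3 ≤ N) {h : Fin N → GL TwoQubit ℂ} {L : Fin N → LocalOp}
    (hL : IsMultiple (applyLocal L (networkState N)) (applyLocal (toOps h) (networkState N)))
    (hL0 : applyLocal L (networkState N) ≠ 0) (j : Fin N) : IsUnit (L j) := by
  obtain ⟨c, hc⟩ := hL
  refine isUnit_of_applyLocal_eq_smul (add_one_ne_self (by omega) j) ?_ hc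
  rintro rfl
  exact hL0 (by rw [hc, zero_smul])

/-- Along a branch of non-zero probability, the party that measures in the last round satisfies the
single-round condition. -/
theorem exists_singleRoundCondition_of_protocol (hN : 3 ≤ N) (h : Fin N → GL TwoQubit ℂ)
    (P : Protocol N) (hP : P ≠ .done) (hcount : P.EachPartyMeasuresOnce) (L : Fin N → LocalOp)
    (hL0 : applyLocal L (networkState N) ≠ 0)
    (hL : ∀ j, P.measurementCount j ≠ 0 → (L j)ᴴ * L j = 1)
    (hdet : P.Deterministic (applyLocal L (networkState N)))
    (hreach : P.Reaches (applyLocal L (networkState N))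
      (applyLocal (toOps h) (networkState N))) :
    ∃ (k : Fin N) (A B : Matrix.SpecialLinearGroup (Fin 2) ℂ),
      SingleRoundCondition h k ((A.1ᴴ * A.1) ⊗ₖ (B.1ᴴ * B.1)) := by
  induction P generalizing L with
  | done => exact absurd rfl hP
  | measure k m M complete U next ih =>
    obtain ⟨i₀, hi₀⟩ := exists_applyLocal_roundOp_ne_zero (k := k) complete U hL0
    have hle : ∀ i j, (next i).measurementCount j ≤
        Finset.univ.sup fun i => (next i).measurementCount j := fun i j =>
      Finset.le_sup (f := fun i => (next i).measurementCount j) (Finset.mem_univ i)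
    by_cases hdone : next i₀ = .done
    · have hr₀ := hreach i₀
      rw [hdone] at hr₀
      -- Only the branch `i₀` is known to stop here. Determinism of the round shows that the other
      -- outcomes give multiples of the target state too.
      obtain ⟨⟨φ', hφ'⟩, -⟩ := hdet
      obtain ⟨c₀, hc₀⟩ := hr₀
      obtain ⟨d₀, hd₀⟩ := hφ' i₀
      have hd0 : d₀ ≠ 0 := by
        rintro rfl
        exact hi₀ (by rw [hd₀, zero_smul])
      have hφ : φ' = (d₀⁻¹ * c₀) • applyLocal (toOps h) (networkState N) := by
        rw [← smul_smul, ← hc₀, hd₀, smul_smul, inv_mul_cancel₀ hd0, one_smul]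
      have hMU : ∀ i, IsMultiple (applyLocal (roundOp k (M i) (U i))
          (applyLocal L (networkState N))) (applyLocal (toOps h) (networkState N)) := by
        intro i
        obtain ⟨d, hd⟩ := hφ' i
        exact ⟨d * (d₀⁻¹ * c₀), by rw [hd, hφ, smul_smul]⟩
      have hunit : ∀ j, IsUnit (L j) := by
        intro j
        have h1 := hMU i₀
        have h2 := hi₀
        rw [applyLocal_applyLocal] at h1 h2
        have h3 := isUnit_of_isMultiple hN h1 h2 j
        exact isUnit_of_mul_isUnit_right h3
      choose g hg using hunit
      have hLg : L = toOps g := funext fun j => (hg j).symm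
      refine ⟨k, singleRoundCondition_of_last_round hN (g := g) ?_ complete
        (U := U) (by rwa [← hLg]) (i₀ := i₀) (by rwa [← hLg])⟩
      rw [hg k]
      exact hL k (by simp [Protocol.measurementCount])
    · refine ih i₀ hdone (fun j => ?_) (roundOp k (M i₀) (U i₀) * L) ?_ (fun j hj => ?_) ?_ ?_
      · have h1 := hcount j
        rw [Protocol.measurementCount] at h1
        exact (hle i₀ j).trans (by omega)
      · rwa [← applyLocal_applyLocal]
      · have h1 := hcount j
        have h2 := hle i₀ j
        rw [Protocol.measurementCount] at h1
        -- A party that still has to measure is not `k`, so this round acts on it by a unitary and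
        -- its operator stays unitary.
        have hjk : j ≠ k := by
          rintro rfl
          simp only [if_true] at h1
          omega
        have h3 := hL j (by rw [Protocol.measurementCount]; omega)
        simp only [roundOp, Pi.mul_apply, Function.update_of_ne hjk, Matrix.conjTranspose_mul]
        have h4 : (U i₀ j : LocalOp)ᴴ * (U i₀ j : LocalOp) = 1 :=
          Matrix.mem_unitaryGroup_iff'.mp (U i₀ j).2
        rw [mul_assoc, ← mul_assoc (U i₀ j : LocalOp)ᴴ, h4, one_mul, h3]
      · rw [← applyLocal_applyLocal]
        exact hdet.2 i₀
      · rw [← applyLocal_applyLocal]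
        exact hreach i₀

/-- The empty protocol is treated as a last round with the single Kraus operator 1. -/
theorem singleRoundCondition_of_isMultiple (hN : 3 ≤ N) {h : Fin N → GL TwoQubit ℂ}
    (hh : IsMultiple (networkState N) (applyLocal (toOps h) (networkState N))) (k : Fin N) :
    ∃ A B : Matrix.SpecialLinearGroup (Fin 2) ℂ,
      SingleRoundCondition h k ((A.1ᴴ * A.1) ⊗ₖ (B.1ᴴ * B.1)) := by
  have h1 : ∑ _i : Fin 1, (1 : LocalOp)ᴴ * 1 = 1 := by simp
  have h2 : applyLocal (roundOp k 1 1) (applyLocal (toOps 1) (networkState N)) =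
      networkState N := by
    have : roundOp k 1 1 = (1 : Fin N → LocalOp) := by
      funext j
      by_cases hj : j = k
      · subst hj; simp [roundOp]
      · simp [roundOp, hj]
    rw [this, toOps_one, applyLocal_one, applyLocal_one]
  refine singleRoundCondition_of_last_round hN (g := 1) (by simp) h1 (U := fun _ => 1)
    (fun _ => by rwa [h2]) (i₀ := 0) ?_
  rw [h2]
  have := applyLocal_toOps_networkState_ne_zero hN (1 : Fin N → GL TwoQubit ℂ)
  rwa [toOps_one, applyLocal_one] at this

end Necessity

end CycleNetwork

theorem mainTheorem3 (N : ℕ) [NeZero N] (hN : 3 ≤ N)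
    (h : Fin N → GL CycleNetwork.TwoQubit ℂ) :
    (∃ P : CycleNetwork.Protocol N,
        P.EachPartyMeasuresOnce ∧
        P.Deterministic (CycleNetwork.networkState N) ∧
        P.Reaches (CycleNetwork.networkState N)
          (CycleNetwork.applyLocal (fun j => (h j : CycleNetwork.LocalOp))
            (CycleNetwork.networkState N))) ↔
      ∃ (k : Fin N) (A B : Matrix.SpecialLinearGroup (Fin 2) ℂ),
        CycleNetwork.SingleRoundCondition h k
          (((A : Matrix (Fin 2) (Fin 2) ℂ)ᴴ * (A : Matrix (Fin 2) (Fin 2) ℂ)) ⊗ₖ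
            ((B : Matrix (Fin 2) (Fin 2) ℂ)ᴴ * (B : Matrix (Fin 2) (Fin 2) ℂ))) := by
  constructor
  · rintro ⟨P, hcount, hdet, hreach⟩
    by_cases hP : P = .done
    · subst hP
      exact ⟨0, CycleNetwork.singleRoundCondition_of_isMultiple hN hreach 0⟩
    · have h0 := CycleNetwork.applyLocal_toOps_networkState_ne_zero hN
        (1 : Fin N → GL CycleNetwork.TwoQubit ℂ)
      rw [CycleNetwork.toOps_one] at h0
      rw [← CycleNetwork.applyLocal_one (CycleNetwork.networkState N)] at hdet hreach
      refine CycleNetwork.exists_singleRoundCondition_of_protocol hN h P hP hcount 1 h0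
        (fun j _ => by simp) hdet ?_
      rwa [CycleNetwork.applyLocal_one (CycleNetwork.networkState N)] at hreach ⊢
  · rintro ⟨k, A, B, hS⟩
    obtain ⟨P, hcount, hdet, hreach⟩ :=
      CycleNetwork.reachable_of_singleRoundCondition hN hS
    refine ⟨P, fun j => (hcount j).trans ?_, hdet, hreach⟩
    split_ifs <;> omega
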